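/- **Setting.** Let $\mathcal S,\mathcal A$ be finite nonempty sets, $R:\mathcal S\times\mathcal A\to[0,1]$ a reward, $\gamma\in[0,1)$, $\lambda>0$, and let $f(s)=(s-1)^2$ for $s\ge 0$. For probability vectors $Q,P$ on $\mathcal S$ put $D_f(Q\|P)=\sum_{s}P(s)f(Q(s)/P(s))$ if $Q\ll P$ and $D_f(Q\|P)=+\infty$ otherwise. For a transition function $P^*:\mathcal S\times\mathcal A\to\Delta(\mathcal S)$ the optimal penalized robust value function is $$V^*_{\mathrm{rob},p}(s)=\sup_{\pi}\ \inf_{P}\ \mathbb E_{P,\pi}\Big[\sum_{t\ge0}\gamma^t\big(R(s_t,a_t)+\lambda\gamma D_f(P(\cdot|s_t,a_t)\|P^*(\cdot|s_t,a_t))\big)\,\Big|\,s_0=s\Big],$$ where $\pi$ ranges over stationary randomized policies $\mathcal S\to\Delta(\mathcal A)$ and $P$ over all transition functions $\mathcal S\times\mathcal A\to\Delta(\mathcal S)$. **Upper bound.** There is an absolute constant $K$ such that the following holds for all such $\mathcal S,\mathcal A,R,P^*,\gamma,\lambda$, all $n\ge1$ and all $\delta\in(0,1)$. Let $X^{(s,a)}_i$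 ($i\le n$, $(s,a)\in\mathcal S\times\mathcal A$) be independent with $X^{(s,a)}_i\sim P^*(\cdot|s,a)$, let $\widehat P(s'|s,a)=\frac1n\sum_{i=1}^n\mathbf 1(X^{(s,a)}_i=s')$, and let $\widehat V^*_{\mathrm{rob},p}$ be the optimal penalized robust value function with $\widehat P$ in place of $P^*$. Then with probability at least $1-\delta$, $$\big\|\widehat V^*_{\mathrm{rob},p}-V^*_{\mathrm{rob},p}\big\|_\infty\le K\,\frac{\max\{\frac1{\lambda(1-\gamma)^2},\lambda\}}{(1-\gamma)\sqrt n}\sqrt{\ln\Big(\frac{2|\mathcal S||\mathcal A|}{\delta}\Big(1+8\max\Big\{\frac1{\lambda(1-\gamma)},1\Big\}\sqrt{2n}\Big)\Big)} .$$ **Lower bounds.** Consider randomized adaptive algorithms which repeatedly choose a pair $(s,a)$, receive an independent sample $s'\sim P^*(\cdot|s,a)$, stop at a (possibly random) time and output a function $\widehat V:\mathcal S\to\mathbb R$. Such an algorithm is $(\varepsilon,\delta)$-correct on a class of penalized robust MDPs if, for every member of the class, with probability at least $1-\delta$ it stops and $\|\widehat V-V^*_{\mathrm{rob},p}\|_\infty\le\varepsilon$.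 For every $C>0$ there are constants $c,\varepsilon_0>0$ depending only on $C$ such that, for all $|\mathcal S|\ge2$, $|\mathcal A|\ge1$, $\gamma\in(3/4,1)$ and $\lambda>0$, there is a class of penalized robust MDPs with these $\mathcal S,\mathcal A,\gamma,\lambda$ and a common known reward function such that, for all $\varepsilon\in(0,\varepsilon_0)$ and $\delta\in(0,1/4]$, every algorithm which is $(\varepsilon,\delta)$-correct on the class draws, on some member of the class, an expected total number of samples of at least $$c\,\frac{|\mathcal S||\mathcal A|\lambda^2}{\varepsilon^2(1-\gamma)^3}\qquad\text{if }\lambda\le C(1-\gamma).$$ Likewise, for every $C>0$ there are constants $c,\varepsilon_0>0$ depending only on $C$ such that, in the same sense, the expected total number of samples is at least $$c\,\frac{|\mathcal S||\mathcal A|}{\varepsilon^2(1-\gamma)^3}\min\Big\{\frac1{16},\frac{\lambda\gamma(1-\gamma)}{2\gamma-1}\Big\}\qquad\text{if }\lambda\ge C(1-\gamma).$$ -/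

import Mathlib

open MeasureTheory ProbabilityTheory
open scoped ENNReal

namespace RobustMDP

noncomputable section

/-- The `f`-divergence `D_f(Q ‖ P) = ∑ x, f (Q x / P x) P x` of two probability vectors on a finite
set when `Q ≪ P`, and `+∞` otherwise.  For convex `f` with `f 1 = 0` the sum is nonnegative,
so it is recorded in `[0, ∞]`. -/
def fDiv {X : Type*} [Fintype X] (f : ℝ → ℝ) (Q P : X → ℝ) : ℝ≥0∞ :=
  open scoped Classical in
  if ∀ x, P x = 0 → Q x = 0 then ENNReal.ofReal (∑ x, f (Q x / P x) * P x) else ⊤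

/-- The function `f(s) = (s - 1)²`. -/
def chiSq (s : ℝ) : ℝ := (s - 1) ^ 2

/-- `P s a` is a probability vector on states for every state-action pair `(s, a)`. -/
def IsTransition {S A : Type*} [Fintype S] (P : S → A → S → ℝ) : Prop :=
  ∀ s a, P s a ∈ stdSimplex ℝ S

/-- A stationary (randomized) policy: `π s` is a probability vector on actions. -/
def IsPolicy {S A : Type*} [Fintype A] (π : S → A → ℝ) : Prop :=
  ∀ s, π s ∈ stdSimplex ℝ A

section Value

variable {S A : Type*} [Fintype S] [Fintype A]

/-- `stateLaw π P s₀ t s` is the probability that `s_t = s` along the trajectory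
`a_t ∼ π(· | s_t)`, `s_{t+1} ∼ P(· | s_t, a_t)` started at `s₀`. -/
def stateLaw (π : S → A → ℝ) (P : S → A → S → ℝ) (s₀ : S) : ℕ → S → ℝ
  | 0 => fun s => open scoped Classical in if s = s₀ then 1 else 0
  | t + 1 => fun s' => ∑ s, ∑ a, stateLaw π P s₀ t s * π s a * P s a s'

/-- The expected penalized discounted return
`E_{P,π}[∑ t, γ^t (R(s_t,a_t) + λ γ D_f(P(·|s_t,a_t) ‖ P₀(·|s_t,a_t))) | s_0 = s₀]`.
All terms are nonnegative, so the expectation is taken term by term in `[0, ∞]`. -/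
def penalizedReturn (f : ℝ → ℝ) (lam γ : ℝ) (R : S → A → ℝ) (P₀ : S → A → S → ℝ)
    (π : S → A → ℝ) (P : S → A → S → ℝ) (s₀ : S) : ℝ≥0∞ :=
  ∑' t : ℕ, ENNReal.ofReal (γ ^ t) * ∑ s, ∑ a, ENNReal.ofReal (stateLaw π P s₀ t s * π s a) *
    (ENNReal.ofReal (R s a) + ENNReal.ofReal (lam * γ) * fDiv f (P s a) (P₀ s a))

/-- The penalized robust value `V^π_{rob,p}` of a policy for the nominal transitions `P₀`:
the infimum of the penalized return over all transition functions `P`. -/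
def penalizedValue (f : ℝ → ℝ) (lam γ : ℝ) (R : S → A → ℝ) (P₀ : S → A → S → ℝ)
    (π : S → A → ℝ) (s : S) : ℝ≥0∞ :=
  ⨅ (P : S → A → S → ℝ) (_ : IsTransition P), penalizedReturn f lam γ R P₀ π P s

/-- The optimal penalized robust value function `V^*_{rob,p} = max_π V^π_{rob,p}`, a real
function on states (the supremum is at most `1 / (1 - γ)` when `R` takes values in `[0, 1]`). -/
def optimalValue (f : ℝ → ℝ) (lam γ : ℝ) (R : S → A → ℝ) (P₀ : S → A → S → ℝ) : S → ℝ :=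
  fun s => (⨆ (π : S → A → ℝ) (_ : IsPolicy π), penalizedValue f lam γ R P₀ π s).toReal

end Value

/-- The empirical transition function
`P̂(s' | s, a) = (1/n) ∑ i, 1(x i (s, a) = s')` of `n` samples per state-action pair. -/
def empirical {S A : Type*} {n : ℕ} (x : S × A × Fin n → S) : S → A → S → ℝ :=
  fun s a s' => open scoped Classical in
    (1 / (n : ℝ)) * ∑ i : Fin n, if x (s, a, i) = s' then (1 : ℝ) else 0

/-- A (randomized, adaptive) algorithm with access to a generative model.  A history is the list
of the samples `(s, a, s')` drawn so far, the most recent one first.  Given the history, the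
algorithm draws from `query` either a pair `some (s, a)`, of which it then asks one more sample
`s' ∼ P(· | s, a)`, or `none`, in which case it stops and draws from `output` its estimate
of the value function. -/
structure Algorithm (S A : Type*) where
  query : List (S × A × S) → PMF (Option (S × A))
  output : List (S × A × S) → Measure (S → ℝ)
  output_prob : ∀ h, IsProbabilityMeasure (output h)

namespace Algorithm

variable {S A : Type*}

/-- The probability, when the generative model has transitions `P`, that the first samples
drawn by the algorithm are those of the given history. -/
def reachProb (alg : Algorithm S A) (P : S → A → S → ℝ) : List (S × A × S) → ℝ≥0∞
  | [] => 1
  | (s, a, s') :: h => reachProb alg P h * alg.query h (some (s, a)) * ENNReal.ofReal (P s a s')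

/-- The probability that the algorithm stops and that its output lies in `B`. -/
def outputProb (alg : Algorithm S A) (P : S → A → S → ℝ) (B : Set (S → ℝ)) : ℝ≥0∞ :=
  ∑' h : List (S × A × S), alg.reachProb P h * alg.query h none * alg.output h B

/-- The expected total number of samples, `∑ t ≥ 1, Pr(at least t samples are drawn)`. The event
that at least `t` samples are drawn is split here according to the first `t` of them. -/
def expectedSamples (alg : Algorithm S A) (P : S → A → S → ℝ) : ℝ≥0∞ :=
  ∑' t : ℕ, ∑' h : {h : List (S × A × S) // h.length = t + 1}, alg.reachProb P h

/-- The algorithm is `(ε, δ)`-correct on the class of penalized robust MDPs with parameters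
`f, lam, γ`, known reward `R` and nominal transitions in `M`: on each of them its output is
within `ε` of the optimal robust value in the supremum norm with probability at least `1 - δ`. -/
def IsCorrect [Fintype S] [Fintype A] (alg : Algorithm S A) (f : ℝ → ℝ) (lam γ : ℝ)
    (R : S → A → ℝ) (M : Set (S → A → S → ℝ)) (ε δ : ℝ) : Prop :=
  ∀ P ∈ M, ENNReal.ofReal (1 - δ) ≤
    alg.outputProb P {v | ‖v - optimalValue f lam γ R P‖ ≤ ε}

end Algorithm

/-- `B` is a lower bound for the number of samples, up to the factor `c`, on some class of penalized
robust MDPs with states `S`, actions `A`, parameters `f, lam, γ` and a common known reward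
function: every algorithm that is `(ε, δ)`-correct on the class, with `0 < ε < ε₀` and
`0 < δ ≤ 1/4`, draws on some member of the class at least `c * B ε` samples in expectation. -/
def SampleLowerBound (S A : Type*) [Fintype S] [Fintype A] (f : ℝ → ℝ) (lam γ ε₀ c : ℝ)
    (B : ℝ → ℝ) : Prop :=
  ∃ (R : S → A → ℝ) (M : Set (S → A → S → ℝ)),
    (∀ s a, R s a ∈ Set.Icc (0 : ℝ) 1) ∧ (∀ P ∈ M, IsTransition P) ∧
    ∀ ε δ : ℝ, 0 < ε → ε < ε₀ → 0 < δ → δ ≤ 1 / 4 →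
      ∀ alg : Algorithm S A, alg.IsCorrect f lam γ R M ε δ →
        ∃ P ∈ M, ENNReal.ofReal (c * B ε) ≤ alg.expectedSamples P

end

end RobustMDP

/-! Everything rests on replacing the optimal robust value by the solution of `V s = max_a (R s a +
γ * robustExp lam (P s a) V)`, where `robustExp` minimizes `∑ Q V + lam * χ²(Q ‖ P)` over `Q ≪ P`.
This map is a `γ`-contraction in the supremum norm. Its fixed point is the value
(`IsBellman.optimalValue_eq`): the adversary that minimizes at every pair holds every policy below
`V`, and the greedy policy secures `V` against every adversary.

Upper bound. By Lagrangian duality `robustExp` is a maximum over a single real `η ∈ [0, 1/(1-γ)]` of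
a linear functional of `P`, the mean of `dualFn lam η (V x)`. The contraction reduces the error of
the plug-in value to the error of the robust expectation of the nominal `V`, which is not random
(`IsBellman.norm_sub_le`). Hoeffding's inequality, a grid of about `√n` values of `η` and a union
bound over pairs and grid points then suffice.

Lower bounds. Both follow from one stronger bound of order `|S||A| / (ε²(1-γ)³)`, free of `lam`. In
the hard model each state other than a sink earns reward 1 and leaks into the sink with probability
`θ`. Decreasing `θ` at one pair `(s₁, a₁)` raises the value at `s₁` by more than `2ε`, because the
optimal policy switches to `a₁`, while the relative entropy between the two transition laws is at
most `2^20 ε²(1-γ)³` (`exists_escape_pair`). A correct algorithm must tell the two models apart, and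
only samples of `(s₁, a₁)` help. Wald's identity for the log-likelihood ratio bounds the expected
number of such samples from below (`Algorithm.le_expectedQueries`). All these counts refer to the
same base model, so they add up over the pairs. -/

namespace RobustMDP

noncomputable section

/-! ### The χ²-penalized expectation and its scalar dual. -/

section RobustExpectation

variable {S : Type*} [Fintype S]

/-- The penalized expectation `∑ Q V + lam * χ²(Q ‖ P)`. -/
def penalizedExp (lam : ℝ) (P V Q : S → ℝ) : ℝ :=
  ∑ x, Q x * V x + lam * ∑ x, chiSq (Q x / P x) * P x

/-- The values `∑ Q V + lam * χ²(Q ‖ P)` over probability vectors `Q ≪ P`. -/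
def penalizedExpSet (lam : ℝ) (P V : S → ℝ) : Set ℝ :=
  {y | ∃ Q ∈ stdSimplex ℝ S, (∀ x, P x = 0 → Q x = 0) ∧ y = penalizedExp lam P V Q}

/-- The robust expectation of `V`. -/
def robustExp (lam : ℝ) (P V : S → ℝ) : ℝ := sInf (penalizedExpSet lam P V)

/-- The integrand `η - lam * f^*((η - v) / lam)` of the dual problem. -/
def dualFn (lam η v : ℝ) : ℝ := η + lam - lam * (max 0 (1 + (η - v) / (2 * lam))) ^ 2

/-- With `z = 1 + (η - v)/(2 lam)`, the right side minus the left is `lam (r - z)²` if `z ≥ 0` and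
`lam (r² - 2 r z)` otherwise. The minimizing density is thus `max 0 z`, which gives the equality in
`dualFn_eq_pointwise`. -/
lemma dualFn_le_pointwise {lam : ℝ} (hl : 0 < lam) (η v : ℝ) {r : ℝ} (hr : 0 ≤ r) :
    dualFn lam η v ≤ r * v + lam * (r - 1) ^ 2 - η * r + η := by
  set z := 1 + (η - v) / (2 * lam) with hz
  have hv : v = η - 2 * lam * (z - 1) := by rw [hz]; field_simp; ring
  unfold dualFn
  rw [← hz, hv]
  rcases le_total 0 z with h | h
  · rw [max_eq_right h]; nlinarith [mul_nonneg hl.le (sq_nonneg (r - z))]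
  · rw [max_eq_left h]
    nlinarith [mul_nonneg hl.le (sq_nonneg r), mul_nonneg (mul_nonneg hl.le hr) (neg_nonneg.2 h)]

lemma dualFn_eq_pointwise {lam : ℝ} (hl : 0 < lam) (η v : ℝ) :
    dualFn lam η v = max 0 (1 + (η - v) / (2 * lam)) * v
      + lam * (max 0 (1 + (η - v) / (2 * lam)) - 1) ^ 2
      - η * max 0 (1 + (η - v) / (2 * lam)) + η := by
  set z := 1 + (η - v) / (2 * lam) with hz
  have hv : v = η - 2 * lam * (z - 1) := by rw [hz]; field_simp; ring
  unfold dualFn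
  rw [← hz, hv]
  rcases le_total 0 z with h | h
  · rw [max_eq_right h]; ring
  · rw [max_eq_left h]; ring

lemma sum_dualFn_le {lam : ℝ} (hl : 0 < lam) (η : ℝ) {P Q : S → ℝ} (V : S → ℝ)
    (hP : P ∈ stdSimplex ℝ S) (hQ : Q ∈ stdSimplex ℝ S) (hQP : ∀ x, P x = 0 → Q x = 0) :
    ∑ x, P x * dualFn lam η (V x) ≤ penalizedExp lam P V Q := by
  have key : ∀ x, P x * dualFn lam η (V x) ≤
      Q x * V x + lam * (chiSq (Q x / P x) * P x) - η * Q x + η * P x := by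
    intro x
    rcases eq_or_ne (P x) 0 with h | h
    · simp [h, hQP x h]
    · have h1 := mul_le_mul_of_nonneg_left
        (dualFn_le_pointwise hl η (V x) (div_nonneg (hQ.1 x) (hP.1 x))) (hP.1 x)
      refine h1.trans (le_of_eq ?_)
      unfold chiSq
      field_simp
  refine (Finset.sum_le_sum fun x _ => key x).trans (le_of_eq ?_)
  simp only [Finset.sum_add_distrib, Finset.sum_sub_distrib, ← Finset.mul_sum, hP.2, hQ.2,
    penalizedExp]
  ring

/-- The candidate `Q` has density `max 0 (1 + (η - V)/(2 lam))`, and `η` must make its total mass 1.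
The density is at most 1 for `η = lo` and at least 1 for `η = hi`, so the intermediate value theorem
provides `η` and also confines it to `[lo, hi]`, a compact range that can later be discretized. -/
lemma exists_dual_optimizer {lam : ℝ} (hl : 0 < lam) {P : S → ℝ} (V : S → ℝ)
    (hP : P ∈ stdSimplex ℝ S) {lo hi : ℝ} (hlo : ∀ x, lo ≤ V x) (hhi : ∀ x, V x ≤ hi) :
    ∃ η ∈ Set.Icc lo hi, ∃ Q ∈ stdSimplex ℝ S, (∀ x, P x = 0 → Q x = 0) ∧
      penalizedExp lam P V Q = ∑ x, P x * dualFn lam η (V x) := by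
  have hne : Nonempty S := by
    by_contra h
    rw [not_nonempty_iff] at h
    simpa using hP.2
  obtain ⟨x₀⟩ := hne
  have hlh : lo ≤ hi := (hlo x₀).trans (hhi x₀)
  let F : ℝ → ℝ := fun η => ∑ x, P x * max 0 (1 + (η - V x) / (2 * lam))
  have hF : Continuous F := by
    refine continuous_finsetSum _ fun x _ => ?_
    fun_prop
  have h1 : F lo ≤ 1 := by
    rw [← hP.2]
    refine Finset.sum_le_sum fun x _ => mul_le_of_le_one_right (hP.1 x) (max_le zero_le_one ?_)
    have : (lo - V x) / (2 * lam) ≤ 0 :=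
      div_nonpos_of_nonpos_of_nonneg (by linarith [hlo x]) (by linarith)
    linarith
  have h2 : 1 ≤ F hi := by
    rw [← hP.2]
    refine Finset.sum_le_sum fun x _ => le_mul_of_one_le_right (hP.1 x) (le_max_of_le_right ?_)
    have : 0 ≤ (hi - V x) / (2 * lam) := div_nonneg (by linarith [hhi x]) (by linarith)
    linarith
  obtain ⟨η, hη, hFη⟩ := intermediate_value_Icc hlh hF.continuousOn ⟨h1, h2⟩
  refine ⟨η, hη, fun x => P x * max 0 (1 + (η - V x) / (2 * lam)),
    ⟨fun x => mul_nonneg (hP.1 x) (le_max_left _ _), hFη⟩, fun x hx => by simp [hx], ?_⟩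
  have key : ∀ x, P x * dualFn lam η (V x) =
      P x * max 0 (1 + (η - V x) / (2 * lam)) * V x
        + lam * (chiSq (P x * max 0 (1 + (η - V x) / (2 * lam)) / P x) * P x)
        - η * (P x * max 0 (1 + (η - V x) / (2 * lam))) + η * P x := by
    intro x
    rcases eq_or_ne (P x) 0 with h | h
    · simp [h]
    · rw [dualFn_eq_pointwise hl, mul_div_cancel_left₀ _ h]
      unfold chiSq
      ring
  have hFη' : ∑ x, P x * max 0 (1 + (η - V x) / (2 * lam)) = 1 := hFη
  rw [Finset.sum_congr rfl fun x _ => key x]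
  simp only [Finset.sum_add_distrib, Finset.sum_sub_distrib, ← Finset.mul_sum, hP.2, hFη',
    penalizedExp]
  ring

lemma isLeast_robustExp {lam : ℝ} (hl : 0 < lam) {P : S → ℝ} (V : S → ℝ)
    (hP : P ∈ stdSimplex ℝ S) : IsLeast (penalizedExpSet lam P V) (robustExp lam P V) := by
  obtain ⟨η, -, Q, hQ, hQP, hQη⟩ := exists_dual_optimizer hl V hP
    (lo := -‖V‖) (hi := ‖V‖) (fun x => (abs_le.1 (norm_le_pi_norm V x)).1)
    (fun x => (abs_le.1 (norm_le_pi_norm V x)).2)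
  have : IsLeast (penalizedExpSet lam P V) (penalizedExp lam P V Q) := by
    refine ⟨⟨Q, hQ, hQP, rfl⟩, ?_⟩
    rintro _ ⟨Q', hQ', hQP', rfl⟩
    rw [hQη]
    exact sum_dualFn_le hl η V hP hQ' hQP'
  rw [robustExp, this.csInf_eq]
  exact this

lemma robustExp_le {lam : ℝ} (hl : 0 < lam) {P Q : S → ℝ} (V : S → ℝ)
    (hP : P ∈ stdSimplex ℝ S) (hQ : Q ∈ stdSimplex ℝ S) (hQP : ∀ x, P x = 0 → Q x = 0) :
    robustExp lam P V ≤ penalizedExp lam P V Q :=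
  (isLeast_robustExp hl V hP).2 ⟨Q, hQ, hQP, rfl⟩

lemma exists_robustExp_eq {lam : ℝ} (hl : 0 < lam) {P : S → ℝ} (V : S → ℝ)
    (hP : P ∈ stdSimplex ℝ S) : ∃ Q ∈ stdSimplex ℝ S, (∀ x, P x = 0 → Q x = 0) ∧
      robustExp lam P V = penalizedExp lam P V Q :=
  (isLeast_robustExp hl V hP).1

lemma sum_dualFn_le_robustExp {lam : ℝ} (hl : 0 < lam) (η : ℝ) {P : S → ℝ} (V : S → ℝ)
    (hP : P ∈ stdSimplex ℝ S) : ∑ x, P x * dualFn lam η (V x) ≤ robustExp lam P V := by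
  obtain ⟨Q, hQ, hQP, h⟩ := exists_robustExp_eq hl V hP
  rw [h]
  exact sum_dualFn_le hl η V hP hQ hQP

lemma exists_robustExp_eq_sum_dualFn {lam : ℝ} (hl : 0 < lam) {P : S → ℝ} (V : S → ℝ)
    (hP : P ∈ stdSimplex ℝ S) {lo hi : ℝ} (hlo : ∀ x, lo ≤ V x) (hhi : ∀ x, V x ≤ hi) :
    ∃ η ∈ Set.Icc lo hi, robustExp lam P V = ∑ x, P x * dualFn lam η (V x) := by
  obtain ⟨η, hη, Q, hQ, hQP, h⟩ := exists_dual_optimizer hl V hP hlo hhi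
  exact ⟨η, hη, le_antisymm (h ▸ robustExp_le hl V hP hQ hQP) (sum_dualFn_le_robustExp hl η V hP)⟩

lemma penalty_nonneg {P : S → ℝ} (hP : P ∈ stdSimplex ℝ S) (Q : S → ℝ) :
    0 ≤ ∑ x, chiSq (Q x / P x) * P x :=
  Finset.sum_nonneg fun x _ => mul_nonneg (sq_nonneg _) (hP.1 x)

lemma penalty_self {P : S → ℝ} : ∑ x, chiSq (P x / P x) * P x = 0 := by
  refine Finset.sum_eq_zero fun x _ => ?_
  rcases eq_or_ne (P x) 0 with h | h
  · simp [h]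
  · simp [chiSq, div_self h]

lemma sum_mul_le_of_stdSimplex {Q V : S → ℝ} {c : ℝ} (hQ : Q ∈ stdSimplex ℝ S)
    (h : ∀ x, V x ≤ c) : ∑ x, Q x * V x ≤ c := by
  calc ∑ x, Q x * V x ≤ ∑ x, Q x * c :=
        Finset.sum_le_sum fun x _ => mul_le_mul_of_nonneg_left (h x) (hQ.1 x)
    _ = c := by rw [← Finset.sum_mul, hQ.2, one_mul]

lemma le_sum_mul_of_stdSimplex {Q V : S → ℝ} {c : ℝ} (hQ : Q ∈ stdSimplex ℝ S)
    (h : ∀ x, c ≤ V x) : c ≤ ∑ x, Q x * V x := by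
  calc c = ∑ x, Q x * c := by rw [← Finset.sum_mul, hQ.2, one_mul]
    _ ≤ ∑ x, Q x * V x :=
        Finset.sum_le_sum fun x _ => mul_le_mul_of_nonneg_left (h x) (hQ.1 x)

lemma robustExp_le_of_le {lam : ℝ} (hl : 0 < lam) {P V : S → ℝ} {c : ℝ}
    (hP : P ∈ stdSimplex ℝ S) (h : ∀ x, V x ≤ c) : robustExp lam P V ≤ c := by
  refine (robustExp_le hl V hP hP fun x hx => hx).trans ?_
  rw [penalizedExp, penalty_self, mul_zero, add_zero]
  exact sum_mul_le_of_stdSimplex hP h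

lemma le_robustExp_of_le {lam : ℝ} (hl : 0 < lam) {P V : S → ℝ} {c : ℝ}
    (hP : P ∈ stdSimplex ℝ S) (h : ∀ x, c ≤ V x) : c ≤ robustExp lam P V := by
  obtain ⟨Q, hQ, -, hQV⟩ := exists_robustExp_eq hl V hP
  rw [hQV, penalizedExp]
  linarith [le_sum_mul_of_stdSimplex hQ h, mul_nonneg hl.le (penalty_nonneg hP Q)]

/-- The minimizer for `W` is a competitor for `V`, with the same penalty. -/
lemma robustExp_le_add_norm_sub {lam : ℝ} (hl : 0 < lam) {P : S → ℝ} (V W : S → ℝ)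
    (hP : P ∈ stdSimplex ℝ S) : robustExp lam P V ≤ robustExp lam P W + ‖V - W‖ := by
  obtain ⟨Q, hQ, hQP, hQW⟩ := exists_robustExp_eq hl W hP
  refine (robustExp_le hl V hP hQ hQP).trans ?_
  rw [hQW]
  have h1 : ∑ x, Q x * (V - W) x ≤ ‖V - W‖ :=
    sum_mul_le_of_stdSimplex hQ fun x => (abs_le.1 (norm_le_pi_norm (V - W) x)).2
  simp only [Pi.sub_apply, mul_sub, Finset.sum_sub_distrib] at h1
  simp only [penalizedExp]
  linarith

end RobustExpectation

/-! ### The optimality equation: bounds and existence of a solution. -/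

section Bellman

variable {S A : Type*} [Fintype S]

/-- `V` solves the optimality equation
`V s = max_a (R s a + γ * robustExp lam (P s a) V)`. -/
structure IsBellman (lam γ : ℝ) (R : S → A → ℝ) (P : S → A → S → ℝ) (V : S → ℝ) : Prop where
  le_value : ∀ s a, R s a + γ * robustExp lam (P s a) V ≤ V s
  value_le : ∀ s, ∃ a, V s ≤ R s a + γ * robustExp lam (P s a) V

lemma IsBellman.nonneg {lam γ : ℝ} {R : S → A → ℝ} {P : S → A → S → ℝ} {V : S → ℝ}
    (hV : IsBellman lam γ R P V) (hl : 0 < lam) (hγ0 : 0 ≤ γ) (hγ1 : γ < 1)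
    (hR : ∀ s a, R s a ∈ Set.Icc (0 : ℝ) 1) (hP : IsTransition P) (s : S) : 0 ≤ V s := by
  obtain ⟨s₁, -, hs₁⟩ := Finset.exists_min_image Finset.univ V ⟨s, Finset.mem_univ s⟩
  obtain ⟨a, -⟩ := hV.value_le s₁
  have h1 := hV.le_value s₁ a
  have h2 := mul_le_mul_of_nonneg_left
    (le_robustExp_of_le hl (hP s₁ a) fun x => hs₁ x (Finset.mem_univ x)) hγ0
  have h3 := (hR s₁ a).1
  have h4 : 0 ≤ V s₁ := by nlinarith
  exact h4.trans (hs₁ s (Finset.mem_univ s))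

lemma IsBellman.le_inv {lam γ : ℝ} {R : S → A → ℝ} {P : S → A → S → ℝ} {V : S → ℝ}
    (hV : IsBellman lam γ R P V) (hl : 0 < lam) (hγ0 : 0 ≤ γ) (hγ1 : γ < 1)
    (hR : ∀ s a, R s a ∈ Set.Icc (0 : ℝ) 1) (hP : IsTransition P) (s : S) :
    V s ≤ 1 / (1 - γ) := by
  obtain ⟨s₁, -, hs₁⟩ := Finset.exists_max_image Finset.univ V ⟨s, Finset.mem_univ s⟩
  obtain ⟨a, h1⟩ := hV.value_le s₁
  have h2 := mul_le_mul_of_nonneg_left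
    (robustExp_le_of_le hl (hP s₁ a) fun x => hs₁ x (Finset.mem_univ x)) hγ0
  have h3 := (hR s₁ a).2
  refine (hs₁ s (Finset.mem_univ s)).trans ?_
  rw [le_div_iff₀ (by linarith)]
  nlinarith

/-- Banach's fixed point theorem: `robustExp` is 1-Lipschitz in the supremum norm, a maximum over
actions preserves this, and the discount contributes the factor `γ`. -/
lemma exists_isBellman [Fintype A] [Nonempty A] {lam γ : ℝ} (hl : 0 < lam) (hγ0 : 0 ≤ γ) (hγ1 : γ < 1)
    (R : S → A → ℝ) {P : S → A → S → ℝ} (hP : IsTransition P) :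
    ∃ V : S → ℝ, IsBellman lam γ R P V := by
  let T : (S → ℝ) → S → ℝ := fun V s =>
    Finset.univ.sup' Finset.univ_nonempty fun a => R s a + γ * robustExp lam (P s a) V
  have hle : ∀ V W s, T V s ≤ T W s + γ * ‖V - W‖ := by
    intro V W s
    refine Finset.sup'_le _ _ fun a ha => ?_
    have h1 := Finset.le_sup' (fun a => R s a + γ * robustExp lam (P s a) W) ha
    have h2 := mul_le_mul_of_nonneg_left (robustExp_le_add_norm_sub hl V W (hP s a)) hγ0
    change _ ≤ T W s at h1
    linarith
  have hT : ContractingWith ⟨γ, hγ0⟩ T := by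
    refine ⟨by exact_mod_cast hγ1, LipschitzWith.of_dist_le_mul fun V W => ?_⟩
    rw [dist_eq_norm, dist_eq_norm]
    refine (pi_norm_le_iff_of_nonneg (mul_nonneg hγ0 (norm_nonneg _))).2 fun s => ?_
    change ‖_‖ ≤ γ * _
    rw [Pi.sub_apply, Real.norm_eq_abs, abs_le]
    have h1 := hle V W s
    have h2 := hle W V s
    rw [norm_sub_rev] at h2
    constructor <;> linarith
  refine ⟨hT.fixedPoint, ⟨fun s a => ?_, fun s => ?_⟩⟩
  · have := congrFun hT.fixedPoint_isFixedPt s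
    conv_rhs => rw [← this]
    exact Finset.le_sup' (fun a => R s a + γ * robustExp lam (P s a) hT.fixedPoint)
      (Finset.mem_univ a)
  · have := congrFun hT.fixedPoint_isFixedPt s
    obtain ⟨a, -, ha⟩ := Finset.exists_mem_eq_sup' (Finset.univ_nonempty (α := A))
      fun a => R s a + γ * robustExp lam (P s a) hT.fixedPoint
    exact ⟨a, (this.symm.trans ha).le⟩

end Bellman

/-! ### The optimal robust value solves the optimality equation. -/

section Verification

lemma sum_policy {S A : Type*} [Fintype A] {π : S → A → ℝ} (hπ : IsPolicy π) (s : S) :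
    ∑ a, ENNReal.ofReal (π s a) = 1 := by
  rw [← ENNReal.ofReal_sum_of_nonneg fun a _ => (hπ s).1 a, (hπ s).2, ENNReal.ofReal_one]

variable {S A : Type*} [Fintype S] [Fintype A]

lemma stateLaw_nonneg {π : S → A → ℝ} {P : S → A → S → ℝ} (hπ : IsPolicy π) (hP : IsTransition P)
    (s₀ : S) (t : ℕ) (s : S) : 0 ≤ stateLaw π P s₀ t s := by
  induction t generalizing s with
  | zero => simp only [stateLaw]; split_ifs <;> norm_num
  | succ t ih =>
    exact Finset.sum_nonneg fun x _ => Finset.sum_nonneg fun a _ =>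
      mul_nonneg (mul_nonneg (ih x) ((hπ x).1 a)) ((hP x a).1 s)

/-- The expectation of `W (s_t)` along the trajectory. -/
def stateMean (π : S → A → ℝ) (P : S → A → S → ℝ) (W : S → ℝ≥0∞) (s₀ : S) (t : ℕ) : ℝ≥0∞ :=
  ∑ s, ENNReal.ofReal (stateLaw π P s₀ t s) * W s

/-- The expectation of `c (s_t, a_t)` along the trajectory. -/
def costMean (π : S → A → ℝ) (P : S → A → S → ℝ) (c : S → A → ℝ≥0∞) (s₀ : S) (t : ℕ) : ℝ≥0∞ :=
  ∑ s, ∑ a, ENNReal.ofReal (stateLaw π P s₀ t s * π s a) * c s a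

lemma stateMean_zero (π : S → A → ℝ) (P : S → A → S → ℝ) (W : S → ℝ≥0∞) (s₀ : S) :
    stateMean π P W s₀ 0 = W s₀ := by
  classical
  rw [stateMean, Finset.sum_eq_single s₀]
  · simp [stateLaw]
  · intro s _ hs
    simp [stateLaw, hs]
  · simp

lemma stateMean_succ {π : S → A → ℝ} {P : S → A → S → ℝ} (hπ : IsPolicy π) (hP : IsTransition P)
    (W : S → ℝ≥0∞) (s₀ : S) (t : ℕ) :
    stateMean π P W s₀ (t + 1) =
      costMean π P (fun s a => ∑ s', ENNReal.ofReal (P s a s') * W s') s₀ t := by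
  have h0 := stateLaw_nonneg hπ hP s₀ t
  have h1 : ∀ s', ENNReal.ofReal (stateLaw π P s₀ (t + 1) s') =
      ∑ s, ∑ a, ENNReal.ofReal (stateLaw π P s₀ t s * π s a) * ENNReal.ofReal (P s a s') := by
    intro s'
    rw [stateLaw, ENNReal.ofReal_sum_of_nonneg fun s _ => Finset.sum_nonneg fun a _ =>
      mul_nonneg (mul_nonneg (h0 s) ((hπ s).1 a)) ((hP s a).1 s')]
    refine Finset.sum_congr rfl fun s _ => ?_
    rw [ENNReal.ofReal_sum_of_nonneg fun a _ =>
      mul_nonneg (mul_nonneg (h0 s) ((hπ s).1 a)) ((hP s a).1 s')]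
    exact Finset.sum_congr rfl fun a _ =>
      ENNReal.ofReal_mul (mul_nonneg (h0 s) ((hπ s).1 a))
  simp only [stateMean, costMean, h1, Finset.sum_mul, Finset.mul_sum]
  rw [Finset.sum_comm]
  refine Finset.sum_congr rfl fun s _ => ?_
  rw [Finset.sum_comm]
  exact Finset.sum_congr rfl fun a _ => Finset.sum_congr rfl fun s' _ => by ring

lemma costMean_add (π : S → A → ℝ) (P : S → A → S → ℝ) (c d : S → A → ℝ≥0∞) (s₀ : S) (t : ℕ) :
    costMean π P (fun s a => c s a + d s a) s₀ t = costMean π P c s₀ t + costMean π P d s₀ t := by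
  simp only [costMean, mul_add, Finset.sum_add_distrib]

lemma costMean_mul (π : S → A → ℝ) (P : S → A → S → ℝ) (g : ℝ≥0∞) (c : S → A → ℝ≥0∞) (s₀ : S)
    (t : ℕ) : costMean π P (fun s a => g * c s a) s₀ t = g * costMean π P c s₀ t := by
  simp only [costMean, Finset.mul_sum]
  exact Finset.sum_congr rfl fun s _ => Finset.sum_congr rfl fun a _ => by ring

lemma costMean_le_stateMean {π : S → A → ℝ} {P : S → A → S → ℝ} (hπ : IsPolicy π)
    (hP : IsTransition P) {c : S → A → ℝ≥0∞} {W : S → ℝ≥0∞}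
    (h : ∀ s, ∑ a, ENNReal.ofReal (π s a) * c s a ≤ W s) (s₀ : S) (t : ℕ) :
    costMean π P c s₀ t ≤ stateMean π P W s₀ t := by
  refine Finset.sum_le_sum fun s _ => ?_
  simp only [ENNReal.ofReal_mul (stateLaw_nonneg hπ hP s₀ t s), mul_assoc, ← Finset.mul_sum]
  exact mul_le_mul_right (h s) _

lemma stateMean_le_costMean {π : S → A → ℝ} {P : S → A → S → ℝ} (hπ : IsPolicy π)
    (hP : IsTransition P) {c : S → A → ℝ≥0∞} {W : S → ℝ≥0∞}
    (h : ∀ s, W s ≤ ∑ a, ENNReal.ofReal (π s a) * c s a) (s₀ : S) (t : ℕ) :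
    stateMean π P W s₀ t ≤ costMean π P c s₀ t := by
  refine Finset.sum_le_sum fun s _ => ?_
  simp only [ENNReal.ofReal_mul (stateLaw_nonneg hπ hP s₀ t s), mul_assoc, ← Finset.mul_sum]
  exact mul_le_mul_right (h s) _

lemma stateMean_const_le {π : S → A → ℝ} {P : S → A → S → ℝ} (hπ : IsPolicy π)
    (hP : IsTransition P) (c : ℝ≥0∞) (s₀ : S) (t : ℕ) :
    stateMean π P (fun _ => c) s₀ t ≤ c := by
  induction t with
  | zero => rw [stateMean_zero]
  | succ t ih =>
    rw [stateMean_succ hπ hP]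
    refine (costMean_le_stateMean hπ hP (W := fun _ => c) (fun s => ?_) s₀ t).trans ih
    have : ∀ a, ∑ s', ENNReal.ofReal (P s a s') * c = c := fun a => by
      rw [← Finset.sum_mul, ← ENNReal.ofReal_sum_of_nonneg fun x _ => (hP s a).1 x, (hP s a).2,
        ENNReal.ofReal_one, one_mul]
    simp only [this, ← Finset.sum_mul, sum_policy hπ, one_mul, le_refl]

/-- A supersolution of the evaluation equation bounds the discounted cost from above. -/
lemma tsum_costMean_le {π : S → A → ℝ} {P : S → A → S → ℝ} (hπ : IsPolicy π)
    (hP : IsTransition P) {c : S → A → ℝ≥0∞} {W : S → ℝ≥0∞} {g : ℝ≥0∞}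
    (h : ∀ s a, c s a + g * ∑ s', ENNReal.ofReal (P s a s') * W s' ≤ W s) (s₀ : S) :
    ∑' t : ℕ, g ^ t * costMean π P c s₀ t ≤ W s₀ := by
  have step : ∀ t, costMean π P c s₀ t + g * stateMean π P W s₀ (t + 1) ≤
      stateMean π P W s₀ t := by
    intro t
    rw [stateMean_succ hπ hP, ← costMean_mul, ← costMean_add]
    refine costMean_le_stateMean hπ hP (fun s => ?_) s₀ t
    calc _ ≤ ∑ a, ENNReal.ofReal (π s a) * W s :=
          Finset.sum_le_sum fun a _ => mul_le_mul_right (h s a) _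
      _ = W s := by rw [← Finset.sum_mul, sum_policy hπ, one_mul]
  have ind : ∀ T : ℕ, ∑ t ∈ Finset.range T, g ^ t * costMean π P c s₀ t
      + g ^ T * stateMean π P W s₀ T ≤ W s₀ := by
    intro T
    induction T with
    | zero => simp [stateMean_zero]
    | succ T ih =>
      refine le_trans (le_of_eq ?_) ((add_le_add le_rfl (mul_le_mul_right (step T) _)).trans ih)
      rw [Finset.sum_range_succ, mul_add, pow_succ]
      ring
  exact ENNReal.tsum_le_of_sum_range_le fun T => le_self_add.trans (ind T)

/-- A bounded subsolution of the evaluation equation bounds the discounted cost from below. -/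
lemma le_tsum_costMean {π : S → A → ℝ} {P : S → A → S → ℝ} (hπ : IsPolicy π)
    (hP : IsTransition P) {c : S → A → ℝ≥0∞} {W : S → ℝ≥0∞} {g K : ℝ≥0∞} (hg : g < 1)
    (hK : K ≠ ⊤) (hW : ∀ s, W s ≤ K)
    (h : ∀ s, W s ≤ ∑ a, ENNReal.ofReal (π s a) *
      (c s a + g * ∑ s', ENNReal.ofReal (P s a s') * W s')) (s₀ : S) :
    W s₀ ≤ ∑' t : ℕ, g ^ t * costMean π P c s₀ t := by
  have step : ∀ t, stateMean π P W s₀ t ≤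
      costMean π P c s₀ t + g * stateMean π P W s₀ (t + 1) := by
    intro t
    rw [stateMean_succ hπ hP, ← costMean_mul, ← costMean_add]
    exact stateMean_le_costMean hπ hP h s₀ t
  have ind : ∀ T : ℕ, W s₀ ≤ ∑ t ∈ Finset.range T, g ^ t * costMean π P c s₀ t
      + g ^ T * stateMean π P W s₀ T := by
    intro T
    induction T with
    | zero => simp [stateMean_zero]
    | succ T ih =>
      refine (ih.trans (add_le_add le_rfl (mul_le_mul_right (step T) _))).trans (le_of_eq ?_)
      rw [Finset.sum_range_succ, mul_add, pow_succ]
      ring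
  have hmean : ∀ T, stateMean π P W s₀ T ≤ K := fun T =>
    (Finset.sum_le_sum fun s _ => mul_le_mul_right (hW s) _).trans
      (stateMean_const_le hπ hP K s₀ T)
  have lim : Filter.Tendsto (fun T : ℕ => (∑' t : ℕ, g ^ t * costMean π P c s₀ t) + g ^ T * K)
      Filter.atTop (nhds ((∑' t : ℕ, g ^ t * costMean π P c s₀ t) + 0 * K)) :=
    tendsto_const_nhds.add
      (ENNReal.Tendsto.mul_const (ENNReal.tendsto_pow_atTop_nhds_zero_of_lt_one hg) (Or.inr hK))
  rw [zero_mul, add_zero] at lim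
  -- Boundedness of `W` makes the remainder `g ^ T * K` vanish; the upper estimate needed no such
  -- bound, as there the remainder is simply dropped.
  exact ge_of_tendsto' lim fun T => (ind T).trans
    (add_le_add (ENNReal.sum_le_tsum _) (mul_le_mul_right (hmean T) _))

lemma penalizedReturn_eq_tsum (f : ℝ → ℝ) (lam : ℝ) {γ : ℝ} (hγ0 : 0 ≤ γ) (R : S → A → ℝ)
    (P₀ : S → A → S → ℝ) (π : S → A → ℝ) (P : S → A → S → ℝ) (s₀ : S) :
    penalizedReturn f lam γ R P₀ π P s₀ = ∑' t : ℕ, ENNReal.ofReal γ ^ t *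
      costMean π P (fun s a => ENNReal.ofReal (R s a) +
        ENNReal.ofReal (lam * γ) * fDiv f (P s a) (P₀ s a)) s₀ t := by
  simp only [penalizedReturn, costMean, ENNReal.ofReal_pow hγ0]

lemma fDiv_of_ac {X : Type*} [Fintype X] {f : ℝ → ℝ} {Q P : X → ℝ}
    (h : ∀ x, P x = 0 → Q x = 0) : fDiv f Q P = ENNReal.ofReal (∑ x, f (Q x / P x) * P x) :=
  if_pos h

lemma fDiv_of_not_ac {X : Type*} [Fintype X] {f : ℝ → ℝ} {Q P : X → ℝ}
    (h : ¬ ∀ x, P x = 0 → Q x = 0) : fDiv f Q P = ⊤ :=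
  if_neg h

/-- Bridge between the cost in `[0, ∞]` of the definitions and the real functional `penalizedExp`.
-/
lemma ofReal_step_eq {lam γ r : ℝ} (hl : 0 < lam) (hγ0 : 0 ≤ γ) (hr : 0 ≤ r) {P Q V : S → ℝ}
    (hP : P ∈ stdSimplex ℝ S) (hQ : Q ∈ stdSimplex ℝ S) (hQP : ∀ x, P x = 0 → Q x = 0)
    (hV : ∀ s, 0 ≤ V s) :
    ENNReal.ofReal r + ENNReal.ofReal (lam * γ) * fDiv chiSq Q P
      + ENNReal.ofReal γ * ∑ s', ENNReal.ofReal (Q s') * ENNReal.ofReal (V s') =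
    ENNReal.ofReal (r + γ * penalizedExp lam P V Q) := by
  have h1 : ∑ s', ENNReal.ofReal (Q s') * ENNReal.ofReal (V s') =
      ENNReal.ofReal (∑ s', Q s' * V s') := by
    rw [ENNReal.ofReal_sum_of_nonneg fun x _ => mul_nonneg (hQ.1 x) (hV x)]
    exact Finset.sum_congr rfl fun x _ => (ENNReal.ofReal_mul (hQ.1 x)).symm
  have h2 : 0 ≤ ∑ s', Q s' * V s' := Finset.sum_nonneg fun x _ => mul_nonneg (hQ.1 x) (hV x)
  have h3 := penalty_nonneg hP Q
  have h4 : 0 ≤ lam * γ := mul_nonneg hl.le hγ0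
  rw [fDiv_of_ac hQP, h1, ← ENNReal.ofReal_mul h4, ← ENNReal.ofReal_mul hγ0,
    ← ENNReal.ofReal_add hr (mul_nonneg h4 h3),
    ← ENNReal.ofReal_add (add_nonneg hr (mul_nonneg h4 h3)) (mul_nonneg hγ0 h2), penalizedExp]
  congr 1
  ring

/-- The optimal robust value function is the solution of the optimality equation. -/
theorem IsBellman.optimalValue_eq {lam γ : ℝ} {R : S → A → ℝ} {P₀ : S → A → S → ℝ} {V : S → ℝ}
    (hV : IsBellman lam γ R P₀ V) (hl : 0 < lam) (hγ0 : 0 ≤ γ) (hγ1 : γ < 1)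
    (hR : ∀ s a, R s a ∈ Set.Icc (0 : ℝ) 1) (hP₀ : IsTransition P₀) :
    optimalValue chiSq lam γ R P₀ = V := by
  classical
  have hV0 := hV.nonneg hl hγ0 hγ1 hR hP₀
  have hV1 := hV.le_inv hl hγ0 hγ1 hR hP₀
  funext s₀
  suffices h : (⨆ (π : S → A → ℝ) (_ : IsPolicy π), penalizedValue chiSq lam γ R P₀ π s₀) =
      ENNReal.ofReal (V s₀) by
    rw [optimalValue, h, ENNReal.toReal_ofReal (hV0 s₀)]
  refine le_antisymm (iSup₂_le fun π hπ => ?_) ?_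
  -- The worst-case transition at each pair depends on `V` only, so a single adversary makes `V` a
  -- supersolution for every policy.
  · choose Q hQ hQP hQV using fun s a => exists_robustExp_eq hl V (hP₀ s a)
    refine (iInf₂_le Q fun s a => hQ s a).trans ?_
    rw [penalizedReturn_eq_tsum _ _ hγ0]
    refine tsum_costMean_le (W := fun s => ENNReal.ofReal (V s)) hπ (fun s a => hQ s a)
      (fun s a => ?_) s₀
    rw [ofReal_step_eq hl hγ0 (hR s a).1 (hP₀ s a) (hQ s a) (hQP s a) hV0, ← hQV]
    exact ENNReal.ofReal_le_ofReal (hV.le_value s a)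
  -- The greedy deterministic policy makes `V` a subsolution against every adversary.
  · choose b hb using hV.value_le
    have hπ : IsPolicy fun s a => if a = b s then (1 : ℝ) else 0 := fun s =>
      ⟨fun a => by dsimp only; split_ifs <;> norm_num, by simp⟩
    refine le_iSup₂_of_le _ hπ (le_iInf₂ fun P hP => ?_)
    rw [penalizedReturn_eq_tsum _ _ hγ0]
    refine le_tsum_costMean (W := fun s => ENNReal.ofReal (V s)) hπ hP
      (by rw [← ENNReal.ofReal_one]; exact (ENNReal.ofReal_lt_ofReal_iff one_pos).2 hγ1)
      ENNReal.ofReal_ne_top (fun s => ENNReal.ofReal_le_ofReal (hV1 s)) (fun s => ?_) s₀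
    rw [Finset.sum_eq_single (b s) (fun a _ ha => by simp [ha]) (by simp), if_pos rfl,
      ENNReal.ofReal_one, one_mul]
    by_cases hac : ∀ x, P₀ s (b s) x = 0 → P s (b s) x = 0
    · rw [ofReal_step_eq hl hγ0 (hR s (b s)).1 (hP₀ s (b s)) (hP s (b s)) hac hV0]
      refine ENNReal.ofReal_le_ofReal ((hb s).trans ?_)
      linarith [mul_le_mul_of_nonneg_left
        (robustExp_le hl V (hP₀ s (b s)) (hP s (b s)) hac) hγ0]
    -- Without absolute continuity the penalty is `⊤`, except that for `γ = 0` it is multiplied by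
    -- zero and disappears; then the reward alone gives the bound.
    · rcases hγ0.eq_or_lt with h0 | h0
      · subst h0
        refine (ENNReal.ofReal_le_ofReal (hb s)).trans ?_
        simp
      · rw [fDiv_of_not_ac hac, ENNReal.mul_top (by
          rw [Ne, ENNReal.ofReal_eq_zero, not_le]; exact mul_pos hl h0)]
        simp

end Verification

/-! ### Stability of the fixed point under a change of transitions. -/

section Perturbation

variable {S A : Type*} [Fintype S]

/-- Solutions of two optimality equations are close when the robust expectations are. -/
lemma IsBellman.norm_sub_le {lam γ : ℝ} {R : S → A → ℝ} {P P' : S → A → S → ℝ} {V V' : S → ℝ}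
    (hV : IsBellman lam γ R P V) (hV' : IsBellman lam γ R P' V') (hl : 0 < lam) (hγ0 : 0 ≤ γ)
    (hγ1 : γ < 1) (hP' : IsTransition P') {e : ℝ} (he0 : 0 ≤ e)
    (he : ∀ s a, |robustExp lam (P' s a) V - robustExp lam (P s a) V| ≤ e) :
    ‖V' - V‖ ≤ e / (1 - γ) := by
  -- Comparing both equations at a maximizing action, the difference splits into a change of
  -- function under `P'`, costing `γ * ‖V' - V‖`, and a change of transitions at the fixed function
  -- `V`, costing at most `e`.
  have h : ‖V' - V‖ ≤ γ * ‖V' - V‖ + e := by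
    refine (pi_norm_le_iff_of_nonneg
      (add_nonneg (mul_nonneg hγ0 (norm_nonneg _)) he0)).2 fun s => ?_
    have hγe : γ * e ≤ e := mul_le_of_le_one_left he0 hγ1.le
    rw [Pi.sub_apply, Real.norm_eq_abs, abs_le]
    constructor
    · obtain ⟨a, ha⟩ := hV.value_le s
      have h1 := hV'.le_value s a
      have h2 := mul_le_mul_of_nonneg_left (robustExp_le_add_norm_sub hl V V' (hP' s a)) hγ0
      have h3 := mul_le_mul_of_nonneg_left (abs_le.1 (he s a)).1 hγ0
      rw [norm_sub_rev] at h2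
      linarith
    · obtain ⟨a, ha⟩ := hV'.value_le s
      have h1 := hV.le_value s a
      have h2 := mul_le_mul_of_nonneg_left (robustExp_le_add_norm_sub hl V' V (hP' s a)) hγ0
      have h3 := mul_le_mul_of_nonneg_left (abs_le.1 (he s a)).2 hγ0
      linarith
  rw [le_div_iff₀ (by linarith)]
  linarith

end Perturbation

/-! ### Range and modulus of continuity of the dual integrand. -/

section DualFunction

lemma dualFn_mem_Icc {lam H η v : ℝ} (hl : 0 < lam) (hη : η ∈ Set.Icc 0 H)
    (hv : v ∈ Set.Icc 0 H) : dualFn lam η v ∈ Set.Icc (-(H ^ 2 / (4 * lam))) H := by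
  constructor
  · have h0 : 0 ≤ η / (2 * lam) := div_nonneg hη.1 (by linarith)
    have h1 : max 0 (1 + (η - v) / (2 * lam)) ≤ 1 + η / (2 * lam) := by
      refine max_le (by linarith) ?_
      gcongr
      linarith [hv.1]
    have h2 : (max 0 (1 + (η - v) / (2 * lam))) ^ 2 ≤ (1 + η / (2 * lam)) ^ 2 :=
      pow_le_pow_left₀ (le_max_left _ _) h1 2
    have h3 := mul_le_mul_of_nonneg_left h2 hl.le
    have h4 : lam * (1 + η / (2 * lam)) ^ 2 = lam + η + η ^ 2 / (4 * lam) := by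
      field_simp; ring
    have h5 : η ^ 2 / (4 * lam) ≤ H ^ 2 / (4 * lam) := by
      gcongr
      exacts [hη.1, hη.2]
    unfold dualFn
    linarith
  · have h1 : 2 * (1 + (η - v) / (2 * lam)) - 1 ≤ (max 0 (1 + (η - v) / (2 * lam))) ^ 2 := by
      rcases le_total 0 (1 + (η - v) / (2 * lam)) with h | h
      · rw [max_eq_right h]; nlinarith [sq_nonneg ((η - v) / (2 * lam))]
      · rw [max_eq_left h]; linarith
    have h2 := mul_le_mul_of_nonneg_left h1 hl.le
    have h3 : lam * (2 * (1 + (η - v) / (2 * lam)) - 1) = lam + η - v := by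
      field_simp; ring
    unfold dualFn
    linarith [hv.2]

/-- With `w`, `w'` the two truncated densities, factor `w² - w'² = (w - w')(w + w')`. Both are at
most `1 + H/(2 lam)`, and truncation at zero does not increase the distance `|η - η'|/(2 lam)`. -/
lemma abs_dualFn_sub_le {lam H η η' v : ℝ} (hl : 0 < lam) (hη : η ∈ Set.Icc 0 H)
    (hη' : η' ∈ Set.Icc 0 H) (hv : 0 ≤ v) :
    |dualFn lam η v - dualFn lam η' v| ≤ (1 + H / (2 * lam)) * |η - η'| := by
  wlog h : η' ≤ η generalizing η η'
  · rw [abs_sub_comm, abs_sub_comm η]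
    exact this hη' hη (le_of_not_ge h)
  have hH : 0 ≤ H := hη.1.trans hη.2
  have hl2 : 0 < 2 * lam := by linarith
  have hdH : 0 ≤ H / (2 * lam) := div_nonneg hH hl2.le
  have hw : ∀ x ∈ Set.Icc 0 H, max 0 (1 + (x - v) / (2 * lam)) ≤ 1 + H / (2 * lam) := by
    intro x hx
    refine max_le (by linarith) ?_
    gcongr
    linarith [hx.2]
  set w := max 0 (1 + (η - v) / (2 * lam)) with hwd
  set w' := max 0 (1 + (η' - v) / (2 * lam)) with hwd'
  have h0 : 0 ≤ w := le_max_left _ _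
  have h0' : 0 ≤ w' := le_max_left _ _
  have h1 := hw η hη
  have h1' := hw η' hη'
  have hmono : w' ≤ w := by
    refine max_le_max le_rfl ?_
    gcongr
  have hdiff : w - w' ≤ (η - η') / (2 * lam) := by
    rw [sub_le_iff_le_add]
    refine max_le (add_nonneg (div_nonneg (by linarith) hl2.le) h0') ?_
    have : 1 + (η' - v) / (2 * lam) ≤ w' := le_max_right _ _
    have e : (η - v) / (2 * lam) = (η - η') / (2 * lam) + (η' - v) / (2 * lam) := by ring
    linarith
  have hq : lam * (w ^ 2 - w' ^ 2) ≤ (1 + H / (2 * lam)) * (η - η') := by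
    have e : w ^ 2 - w' ^ 2 = (w - w') * (w + w') := by ring
    have : (w - w') * (w + w') ≤ (η - η') / (2 * lam) * (2 * (1 + H / (2 * lam))) :=
      mul_le_mul hdiff (by linarith) (by linarith) (div_nonneg (by linarith) hl2.le)
    rw [e]
    refine (mul_le_mul_of_nonneg_left this hl.le).trans (le_of_eq ?_)
    field_simp
  have hq0 : 0 ≤ lam * (w ^ 2 - w' ^ 2) :=
    mul_nonneg hl.le (sub_nonneg.2 (pow_le_pow_left₀ h0' hmono 2))
  have hd : dualFn lam η v - dualFn lam η' v = (η - η') - lam * (w ^ 2 - w' ^ 2) := by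
    unfold dualFn
    rw [← hwd, ← hwd']
    ring
  rw [hd, abs_of_nonneg (sub_nonneg.2 h), abs_le]
  have := mul_nonneg hdH (sub_nonneg.2 h)
  constructor <;> linarith

/-- Two maxima over the same range of `η` differ by at most the uniform distance of the objectives:
each dual optimizer is tested in the other problem. -/
lemma abs_robustExp_sub_le {S : Type*} [Fintype S] {lam H e : ℝ} (hl : 0 < lam) {P Q V : S → ℝ}
    (hP : P ∈ stdSimplex ℝ S) (hQ : Q ∈ stdSimplex ℝ S) (hV : ∀ s, V s ∈ Set.Icc 0 H)
    (h : ∀ η ∈ Set.Icc 0 H,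
      |∑ x, Q x * dualFn lam η (V x) - ∑ x, P x * dualFn lam η (V x)| ≤ e) :
    |robustExp lam Q V - robustExp lam P V| ≤ e := by
  obtain ⟨η, hη, h1⟩ := exists_robustExp_eq_sum_dualFn hl V hP (fun s => (hV s).1)
    fun s => (hV s).2
  obtain ⟨η', hη', h2⟩ := exists_robustExp_eq_sum_dualFn hl V hQ (fun s => (hV s).1)
    fun s => (hV s).2
  have h3 := sum_dualFn_le_robustExp hl η V hQ
  have h4 := sum_dualFn_le_robustExp hl η' V hP
  have h5 := abs_le.1 (h η hη)
  have h6 := abs_le.1 (h η' hη')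
  rw [abs_le]
  constructor <;> linarith [h5.1, h6.2]

end DualFunction

/-! ### Empirical transitions. -/

section Empirical

variable {S A : Type*} {n : ℕ}

lemma sum_empirical_mul [Fintype S] (x : S × A × Fin n → S) (s : S) (a : A) (g : S → ℝ) :
    ∑ s', empirical x s a s' * g s' = (1 / (n : ℝ)) * ∑ i, g (x (s, a, i)) := by
  classical
  have h : ∀ s', empirical x s a s' * g s' =
      (1 / (n : ℝ)) * ∑ i, if x (s, a, i) = s' then g s' else 0 := by
    intro s'
    rw [empirical, mul_assoc, Finset.sum_mul]
    congr 1
    refine Finset.sum_congr rfl fun i _ => ?_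
    by_cases hi : x (s, a, i) = s' <;> simp [hi]
  simp only [h, ← Finset.mul_sum]
  rw [Finset.sum_comm]
  simp

lemma isTransition_empirical [Fintype S] (hn : 0 < n) (x : S × A × Fin n → S) :
    IsTransition (empirical x) := by
  refine fun s a => ⟨fun s' => ?_, ?_⟩
  · refine mul_nonneg (by positivity) (Finset.sum_nonneg fun i _ => ?_)
    split_ifs <;> norm_num
  · have h := sum_empirical_mul x s a fun _ => 1
    simp only [mul_one, Finset.sum_const, Finset.card_univ, Fintype.card_fin, nsmul_eq_mul] at h
    rw [h]
    have : (n : ℝ) ≠ 0 := by positivity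
    field_simp

end Empirical

/-! ### Hoeffding's inequality and expectations under the sample law. -/

section Concentration

variable {Ω : Type*} [MeasurableSpace Ω] {μ : Measure Ω} [IsProbabilityMeasure μ]

/-- Hoeffding's inequality for the mean of i.i.d.-mean bounded variables, two-sided. -/
lemma measureReal_abs_mean_sub_ge_le {n : ℕ} (hn : 0 < n) {Y : Fin n → Ω → ℝ} {a b m t : ℝ}
    (hab : a < b) (ht : 0 ≤ t) (hY : ∀ i, Measurable (Y i)) (hind : iIndepFun Y μ)
    (hb : ∀ i ω, Y i ω ∈ Set.Icc a b) (hm : ∀ i, ∫ ω, Y i ω ∂μ = m) :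
    μ.real {ω | t ≤ |(1 / (n : ℝ)) * ∑ i, Y i ω - m|} ≤
      2 * Real.exp (-(2 * n * t ^ 2 / (b - a) ^ 2)) := by
  have hn' : (0 : ℝ) < n := by exact_mod_cast hn
  have hsub : ∀ i, HasSubgaussianMGF (fun ω => Y i ω - m) ((‖b - a‖₊ / 2) ^ 2) μ := fun i => by
    have := hasSubgaussianMGF_of_mem_Icc (μ := μ) (hY i).aemeasurable
      (Filter.Eventually.of_forall (hb i))
    rwa [hm i] at this
  have hind1 : iIndepFun (fun i ω => Y i ω - m) μ :=
    hind.comp (fun _ y => y - m) fun _ => measurable_id.sub_const m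
  have hind2 : iIndepFun (fun i => -(fun ω => Y i ω - m)) μ :=
    hind.comp (fun _ y => -(y - m)) fun _ => (measurable_id.sub_const m).neg
  have hexp : -(n * t) ^ 2 / (2 * ((∑ _i : Fin n, (‖b - a‖₊ / 2) ^ 2 : NNReal) : ℝ)) =
      -(2 * n * t ^ 2 / (b - a) ^ 2) := by
    have : (b - a) ≠ 0 := by linarith
    have e : (‖b - a‖ / 2) ^ 2 = (b - a) ^ 2 / 4 := by
      rw [div_pow, Real.norm_eq_abs, sq_abs]; norm_num
    push_cast
    rw [e, Finset.sum_const, Finset.card_univ, Fintype.card_fin, nsmul_eq_mul]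
    field_simp
    ring
  have h1 := HasSubgaussianMGF.measure_sum_ge_le_of_iIndepFun hind1 (s := Finset.univ)
    (fun i _ => hsub i) (mul_nonneg hn'.le ht)
  have h2 := HasSubgaussianMGF.measure_sum_ge_le_of_iIndepFun hind2 (s := Finset.univ)
    (fun i _ => (hsub i).neg) (mul_nonneg hn'.le ht)
  rw [hexp] at h1 h2
  have hcov : {ω | t ≤ |(1 / (n : ℝ)) * ∑ i, Y i ω - m|} ⊆
      {ω | n * t ≤ ∑ i, (Y i ω - m)} ∪ {ω | n * t ≤ ∑ i, (-(fun ω => Y i ω - m)) ω} := by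
    intro ω hω
    have e : ∑ i, (Y i ω - m) = n * ((1 / (n : ℝ)) * ∑ i, Y i ω - m) := by
      rw [Finset.sum_sub_distrib, Finset.sum_const, Finset.card_univ, Fintype.card_fin,
        nsmul_eq_mul]
      field_simp
    rcases le_abs.1 hω.out with h | h
    · left
      change n * t ≤ ∑ i, (Y i ω - m)
      rw [e]
      exact mul_le_mul_of_nonneg_left h hn'.le
    · right
      change n * t ≤ ∑ i, (-(Y i ω - m))
      rw [Finset.sum_neg_distrib, e, ← mul_neg]
      exact mul_le_mul_of_nonneg_left h hn'.le
  calc _ ≤ _ := measureReal_mono hcov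
    _ ≤ _ := measureReal_union_le _ _
    _ ≤ _ := by linarith

lemma integral_comp_eq_sum {S : Type*} [Fintype S] [MeasurableSpace S]
    [MeasurableSingletonClass S] {X : Ω → S} (hX : Measurable X) {p : S → ℝ} (hp : ∀ s, 0 ≤ p s)
    (h : ∀ s, μ {ω | X ω = s} = ENNReal.ofReal (p s)) (g : S → ℝ) :
    ∫ ω, g (X ω) ∂μ = ∑ s, p s * g s := by
  have := Measure.isProbabilityMeasure_map (μ := μ) hX.aemeasurable
  rw [← integral_map (f := g) hX.aemeasurable
    (measurable_of_finite g).aestronglyMeasurable, integral_fintype (Integrable.of_finite)]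
  refine Finset.sum_congr rfl fun s _ => ?_
  have : (μ.map X).real {s} = p s := by
    rw [measureReal_def, Measure.map_apply hX (measurableSet_singleton s)]
    change (μ {ω | X ω = s}).toReal = _
    rw [h s, ENNReal.toReal_ofReal (hp s)]
  rw [this, smul_eq_mul]

end Concentration

/-- Every point of `[0, H]` is within `H / m` of a point `k * (H / m)` with `k ≤ m`. -/
lemma exists_grid_point {H η : ℝ} {m : ℕ} (hH : 0 < H) (hm : 0 < m) (hη : η ∈ Set.Icc 0 H) :
    ∃ k : Fin (m + 1), (k : ℝ) * (H / m) ∈ Set.Icc 0 H ∧ |η - k * (H / m)| ≤ H / m := by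
  have hm' : (0 : ℝ) < m := by exact_mod_cast hm
  have hd : 0 < H / m := div_pos hH hm'
  have h0 : 0 ≤ η / (H / m) := div_nonneg hη.1 hd.le
  have h1 := Nat.floor_le h0
  have h2 := Nat.lt_floor_add_one (η / (H / m))
  rw [le_div_iff₀ hd] at h1
  rw [div_lt_iff₀ hd] at h2
  have hk : ⌊η / (H / m)⌋₊ ≤ m := by
    refine Nat.floor_le_of_le ?_
    rw [div_le_iff₀ hd]
    refine hη.2.trans (le_of_eq ?_)
    field_simp
  refine ⟨⟨⌊η / (H / m)⌋₊, Nat.lt_succ_of_le hk⟩, ⟨by positivity, h1.trans hη.2⟩, ?_⟩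
  rw [abs_le]
  constructor <;> simp only <;> linarith

/-! ### Uniform deviation over the dual variable, and the upper bound. -/

section UpperBound

variable {S A Ω : Type*} [Fintype S] [Fintype A]
  [MeasurableSpace S] [MeasurableSingletonClass S] [MeasurableSpace Ω]
  {μ : Measure Ω} [IsProbabilityMeasure μ]

/-- Uniform deviation of the empirical robust expectation of a fixed function. -/
lemma measure_abs_robustExp_empirical_sub_le {lam H M D : ℝ} {V : S → ℝ} {P : S → A → S → ℝ}
    {n m : ℕ} {X : S × A × Fin n → Ω → S}
    (hl : 0 < lam) (hH : 0 < H) (hV : ∀ s, V s ∈ Set.Icc 0 H) (hP : IsTransition P)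
    (hn : 0 < n) (hm : 0 < m) (hX : ∀ j, Measurable (X j)) (hind : iIndepFun X μ)
    (hlaw : ∀ s a i s', μ {ω | X (s, a, i) ω = s'} = ENNReal.ofReal (P s a s'))
    (hHM : H ≤ M) (hHM2 : H ^ 2 / lam ≤ M) (hD : 1 ≤ D) :
    μ {ω | ¬ ∀ s a, |robustExp lam (empirical (fun j => X j ω) s a) V - robustExp lam (P s a) V| ≤
        2 * M * √(Real.log D / (2 * n)) + 3 * M / m} ≤
      ENNReal.ofReal (Fintype.card S * Fintype.card A * (m + 1) * (2 / D)) := by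
  have hM : 0 < M := hH.trans_le hHM
  have hn' : (0 : ℝ) < n := by exact_mod_cast hn
  have hm' : (0 : ℝ) < m := by exact_mod_cast hm
  have hlog : 0 ≤ Real.log D := Real.log_nonneg hD
  set t := 2 * M * √(Real.log D / (2 * n)) with ht
  let bad : S × A × Fin (m + 1) → Set Ω := fun q =>
    {ω | t ≤ |(1 / (n : ℝ)) * ∑ i, dualFn lam (q.2.2 * (H / m)) (V (X (q.1, q.2.1, i) ω)) -
      ∑ x, P q.1 q.2.1 x * dualFn lam (q.2.2 * (H / m)) (V x)|}
  have hgrid : ∀ k : Fin (m + 1), (k : ℝ) * (H / m) ∈ Set.Icc 0 H := by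
    intro k
    refine ⟨by positivity, ?_⟩
    have : (k : ℝ) ≤ m := by exact_mod_cast Nat.le_of_lt_succ k.2
    calc (k : ℝ) * (H / m) ≤ m * (H / m) := by gcongr
      _ = H := by field_simp
  have hbad : ∀ q, μ (bad q) ≤ ENNReal.ofReal (2 / D) := by
    rintro ⟨s, a, k⟩
    -- The interval has length exactly `2 M`, so the exponent in Hoeffding's inequality equals `log
    -- D` for this `t`.
    have key := measureReal_abs_mean_sub_ge_le (μ := μ) hn
      (Y := fun i ω => dualFn lam (k * (H / m)) (V (X (s, a, i) ω)))
      (a := -(H ^ 2 / (4 * lam))) (b := 2 * M - H ^ 2 / (4 * lam))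
      (m := ∑ x, P s a x * dualFn lam (k * (H / m)) (V x)) (t := t) (by linarith) (by positivity)
      (fun i => (measurable_of_finite fun x => dualFn lam (k * (H / m)) (V x)).comp (hX _))
      ((hind.precomp (g := fun i : Fin n => (s, a, i)) fun i j h => by simpa using h).comp
        (fun _ x => dualFn lam (k * (H / m)) (V x)) fun _ => measurable_of_finite _)
      (fun i ω => by
        have h1 := dualFn_mem_Icc hl (hgrid k) (hV (X (s, a, i) ω))
        refine ⟨h1.1, h1.2.trans ?_⟩
        have : H ^ 2 / (4 * lam) = H ^ 2 / lam / 4 := by field_simp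
        linarith)
      (fun i => integral_comp_eq_sum (hX _) (hP s a).1 (hlaw s a i)
        fun x => dualFn lam (k * (H / m)) (V x))
    have e : 2 * n * t ^ 2 / (2 * M - H ^ 2 / (4 * lam) - -(H ^ 2 / (4 * lam))) ^ 2 =
        Real.log D := by
      rw [ht, mul_pow, Real.sq_sqrt (by positivity)]
      field_simp
      ring
    rw [e, Real.exp_neg, Real.exp_log (by linarith), ← div_eq_mul_inv] at key
    change μ {ω | _} ≤ _
    rw [← ENNReal.ofReal_toReal (measure_ne_top μ _)]
    exact ENNReal.ofReal_le_ofReal key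
  have hsub : {ω | ¬ ∀ s a, |robustExp lam (empirical (fun j => X j ω) s a) V -
      robustExp lam (P s a) V| ≤ t + 3 * M / m} ⊆ ⋃ q, bad q := by
    intro ω hω
    by_contra hnot
    refine hω fun s a => abs_robustExp_sub_le hl (hP s a)
      (isTransition_empirical hn (fun j => X j ω) s a) hV fun η hη => ?_
    obtain ⟨k, hk, hkη⟩ := exists_grid_point hH hm hη
    have h1 : ω ∉ bad (s, a, k) := fun h => hnot (Set.mem_iUnion.2 ⟨_, h⟩)
    have h2 : |(1 / (n : ℝ)) * ∑ i, dualFn lam (k * (H / m)) (V (X (s, a, i) ω)) -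
        ∑ x, P s a x * dualFn lam (k * (H / m)) (V x)| < t := not_le.1 h1
    rw [← sum_empirical_mul (fun j => X j ω) s a fun x => dualFn lam (k * (H / m)) (V x)] at h2
    -- Rounding `η` to the grid costs `(3/2) M / m` once under `P` and once under the empirical law,
    -- hence the term `3 M / m`.
    have hlip : ∀ Q ∈ stdSimplex ℝ S, |∑ x, Q x * dualFn lam η (V x) -
        ∑ x, Q x * dualFn lam (k * (H / m)) (V x)| ≤ (3 / 2) * M / m := by
      intro Q hQ
      have hpt : ∀ x, |dualFn lam η (V x) - dualFn lam (k * (H / m)) (V x)| ≤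
          (3 / 2) * M / m := by
        intro x
        refine (abs_dualFn_sub_le hl hη hk (hV x).1).trans ?_
        have h3 : (1 + H / (2 * lam)) * H ≤ (3 / 2) * M := by
          have : (1 + H / (2 * lam)) * H = H + H ^ 2 / lam / 2 := by field_simp
          linarith
        calc (1 + H / (2 * lam)) * |η - k * (H / m)| ≤ (1 + H / (2 * lam)) * (H / m) := by
              gcongr
          _ = (1 + H / (2 * lam)) * H / m := by ring
          _ ≤ _ := by gcongr
      rw [← Finset.sum_sub_distrib]
      simp only [← mul_sub]
      rw [abs_le]
      exact ⟨le_sum_mul_of_stdSimplex hQ fun x => (abs_le.1 (hpt x)).1,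
        sum_mul_le_of_stdSimplex hQ fun x => (abs_le.1 (hpt x)).2⟩
    have h4 := abs_le.1 (hlip _ (hP s a))
    have h5 := abs_le.1 (hlip _ (isTransition_empirical hn (fun j => X j ω) s a))
    have h6 := abs_le.1 h2.le
    have e : 3 * M / m = (3 / 2) * M / m + (3 / 2) * M / m := by ring
    rw [abs_le]
    constructor <;> linarith [h4.1, h4.2, h5.1, h5.2, h6.1, h6.2]
  refine (measure_mono hsub).trans ((measure_iUnion_fintype_le μ bad).trans
    ((Finset.sum_le_sum fun q _ => hbad q).trans (le_of_eq ?_)))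
  rw [Finset.sum_const, nsmul_eq_mul, ← ENNReal.ofReal_natCast, ← ENNReal.ofReal_mul (by positivity)]
  congr 2
  simp only [Finset.card_univ, Fintype.card_prod, Fintype.card_fin]
  push_cast
  ring

/-- High-probability bound for the plug-in estimate of the optimal robust value function. -/
theorem optimalValue_empirical_deviation [Nonempty S] [Nonempty A] {γ lam δ : ℝ} (hγ0 : 0 ≤ γ)
    (hγ1 : γ < 1) (hl : 0 < lam) (hδ0 : 0 < δ) (hδ1 : δ < 1) {R : S → A → ℝ}
    (hR : ∀ s a, R s a ∈ Set.Icc (0 : ℝ) 1) {P : S → A → S → ℝ} (hP : IsTransition P)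
    {n : ℕ} (hn : 0 < n) {X : S × A × Fin n → Ω → S} (hX : ∀ j, Measurable (X j))
    (hind : iIndepFun X μ)
    (hlaw : ∀ s a i s', μ {ω | X (s, a, i) ω = s'} = ENNReal.ofReal (P s a s')) :
    ENNReal.ofReal (1 - δ) ≤
      μ {ω | ‖optimalValue chiSq lam γ R (empirical fun j => X j ω) -
              optimalValue chiSq lam γ R P‖ ≤
        5 * (max (1 / (lam * (1 - γ) ^ 2)) lam / ((1 - γ) * √(n : ℝ))) *
          √(Real.log ((2 * Fintype.card S * Fintype.card A / δ) *
            (1 + 8 * max (1 / (lam * (1 - γ))) 1 * √(2 * (n : ℝ)))))} := by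
  obtain ⟨V, hV⟩ := exists_isBellman hl hγ0 hγ1 R hP
  set M := max (1 / (lam * (1 - γ) ^ 2)) lam with hM
  set D := (2 * Fintype.card S * Fintype.card A / δ) *
            (1 + 8 * max (1 / (lam * (1 - γ))) 1 * √(2 * (n : ℝ))) with hD
  have hg : 0 < 1 - γ := by linarith
  have hH : 0 < 1 / (1 - γ) := one_div_pos.2 hg
  have hM1 : (1 / (1 - γ)) ^ 2 / lam ≤ M := by
    refine le_trans (le_of_eq ?_) (le_max_left _ _)
    field_simp
  have hM2 : lam ≤ M := le_max_right _ _
  have hM0 : 0 < M := hl.trans_le hM2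
  -- With `H = 1/(1-γ)`, `H` is the geometric mean of `H²/lam` and `lam`, both at most `M`.
  have hM3 : 1 / (1 - γ) ≤ M := by
    refine le_of_sq_le_sq ?_ hM0.le
    calc (1 / (1 - γ)) ^ 2 = (1 / (1 - γ)) ^ 2 / lam * lam := by field_simp
      _ ≤ M * M := by gcongr
      _ = M ^ 2 := by ring
  have hn1 : (1 : ℝ) ≤ n := by exact_mod_cast hn
  have hsn : 1 ≤ √(n : ℝ) := Real.one_le_sqrt.2 hn1
  have hs2 : √(n : ℝ) ≤ √(2 * (n : ℝ)) := Real.sqrt_le_sqrt (by linarith)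
  have hmax : 1 ≤ max (1 / (lam * (1 - γ))) 1 := le_max_right _ _
  have hSc : (1 : ℝ) ≤ Fintype.card S := by exact_mod_cast Fintype.card_pos
  have hAc : (1 : ℝ) ≤ Fintype.card A := by exact_mod_cast Fintype.card_pos
  -- With about `√n` grid cells the rounding error is of order `M/√n`, and the `m + 1` grid points
  -- are covered by the factor `1 + 8 max(…) √(2n)` in the logarithm.
  set m := ⌈√(n : ℝ)⌉₊ with hm
  have hm1 : √(n : ℝ) ≤ m := Nat.le_ceil _
  have hm2 : (m : ℝ) < √(n : ℝ) + 1 := Nat.ceil_lt_add_one (by positivity)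
  have hm0 : 0 < m := by
    have : (0 : ℝ) < m := by linarith
    exact_mod_cast this
  have hmD : (m : ℝ) + 1 ≤ 1 + 8 * max (1 / (lam * (1 - γ))) 1 * √(2 * (n : ℝ)) := by
    have : 1 * √(n : ℝ) ≤ max (1 / (lam * (1 - γ))) 1 * √(2 * (n : ℝ)) := by gcongr
    linarith
  have hSA : 1 ≤ (Fintype.card S : ℝ) * Fintype.card A := one_le_mul_of_one_le_of_one_le hSc hAc
  have hfrac : 2 ≤ 2 * Fintype.card S * Fintype.card A / δ := by
    rw [le_div_iff₀ hδ0]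
    nlinarith
  have hD4 : 4 ≤ D := by
    have : (2 : ℝ) ≤ m + 1 := by linarith
    calc (4 : ℝ) = 2 * 2 := by norm_num
      _ ≤ D := mul_le_mul hfrac (this.trans hmD) (by norm_num) (by linarith)
  -- Since `D ≥ 4 > e`, the rounding error `3M/√n` can be absorbed into `3M√(log D)/√n`; together
  -- with the deviation term this gives the constant 5.
  have hL : 1 ≤ Real.log D := by
    rw [Real.le_log_iff_exp_le (by linarith)]
    linarith [Real.exp_one_lt_d9]
  have hprob := measure_abs_robustExp_empirical_sub_le hl hH
    (fun s => ⟨hV.nonneg hl hγ0 hγ1 hR hP s, hV.le_inv hl hγ0 hγ1 hR hP s⟩)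
    hP hn hm0 hX hind hlaw hM3 hM1 (by linarith : 1 ≤ D)
  set G := {ω | ∀ s a, |robustExp lam (empirical (fun j => X j ω) s a) V -
      robustExp lam (P s a) V| ≤ 2 * M * √(Real.log D / (2 * n)) + 3 * M / m} with hG
  have hGc : μ Gᶜ ≤ ENNReal.ofReal δ := by
    refine hprob.trans (ENNReal.ofReal_le_ofReal ?_)
    rw [mul_div_assoc', div_le_iff₀ (by linarith)]
    calc _ = 2 * Fintype.card S * Fintype.card A * ((m : ℝ) + 1) := by ring
      _ ≤ 2 * Fintype.card S * Fintype.card A *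
          (1 + 8 * max (1 / (lam * (1 - γ))) 1 * √(2 * (n : ℝ))) := by gcongr
      _ = δ * D := by rw [hD]; field_simp
  -- Subadditivity alone is used, so measurability of `G` is not needed.
  have hGm : ENNReal.ofReal (1 - δ) ≤ μ G := by
    rw [ENNReal.ofReal_sub _ hδ0.le, ENNReal.ofReal_one, tsub_le_iff_right]
    calc (1 : ℝ≥0∞) = μ Set.univ := measure_univ.symm
      _ = μ (G ∪ Gᶜ) := by rw [Set.union_compl_self]
      _ ≤ μ G + μ Gᶜ := measure_union_le _ _
      _ ≤ _ := by gcongr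
  refine hGm.trans (measure_mono fun ω hω => ?_)
  obtain ⟨V', hV'⟩ := exists_isBellman hl hγ0 hγ1 R (isTransition_empirical hn fun j => X j ω)
  change ‖_‖ ≤ _
  rw [hV.optimalValue_eq hl hγ0 hγ1 hR hP,
    hV'.optimalValue_eq hl hγ0 hγ1 hR (isTransition_empirical hn fun j => X j ω)]
  refine (hV.norm_sub_le hV' hl hγ0 hγ1 (isTransition_empirical hn fun j => X j ω)
    (by positivity) hω).trans ?_
  have hsL : 1 ≤ √(Real.log D) := Real.one_le_sqrt.2 hL
  have e1 : 2 * M * √(Real.log D / (2 * n)) ≤ 2 * M * (√(Real.log D) / √(n : ℝ)) := by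
    rw [Real.sqrt_div (by linarith)]
    gcongr
  have e2 : 3 * M / m ≤ 3 * M * (√(Real.log D) / √(n : ℝ)) := by
    rw [mul_div_assoc']
    refine div_le_div₀ (by positivity) (le_mul_of_one_le_right (by positivity) hsL)
      (by positivity) hm1
  calc _ ≤ (5 * M * (√(Real.log D) / √(n : ℝ))) / (1 - γ) := by
        gcongr
        linarith
    _ = _ := by field_simp

end UpperBound

/-! ### Sums over histories, sorted by length. -/

section Levels

lemma sum_vector_succ {X M : Type*} [Fintype X] [AddCommMonoid M] (n : ℕ) (F : List X → M) :
    ∑ v : List.Vector X (n + 1), F v.toList = ∑ v : List.Vector X n, ∑ x, F (x :: v.toList) := by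
  rw [← Fintype.sum_prod_type']
  refine (Fintype.sum_equiv
    { toFun := fun p : List.Vector X n × X => p.2 ::ᵥ p.1
      invFun := fun v => (v.tail, v.head)
      left_inv := fun p => by simp
      right_inv := fun v => by simp } _ _ fun p => ?_).symm
  rfl

lemma tsum_list_eq {X : Type*} [Fintype X] (F : List X → ℝ≥0∞) :
    ∑' h : List X, F h = ∑' n : ℕ, ∑ v : List.Vector X n, F v.toList := by
  rw [← (Equiv.sigmaFiberEquiv (List.length (α := X))).tsum_eq, ENNReal.tsum_sigma']
  refine tsum_congr fun n => ?_
  exact tsum_fintype (L := .unconditional _) (fun v : List.Vector X n => F v.toList)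

end Levels

/-! ### Change of measure and Wald's identity for adaptive sampling. -/

namespace Algorithm

variable {S A : Type*}

/-- The real probability of asking `o` after the history `h`. -/
def queryReal (alg : Algorithm S A) (h : List (S × A × S)) (o : Option (S × A)) : ℝ :=
  (alg.query h o).toReal

/-- The real version of `reachProb`. -/
def reach (alg : Algorithm S A) (P : S → A → S → ℝ) : List (S × A × S) → ℝ
  | [] => 1
  | (s, a, s') :: h => reach alg P h * alg.queryReal h (some (s, a)) * P s a s'

lemma queryReal_nonneg (alg : Algorithm S A) (h : List (S × A × S)) (o : Option (S × A)) :
    0 ≤ alg.queryReal h o := ENNReal.toReal_nonneg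

lemma ofReal_queryReal (alg : Algorithm S A) (h : List (S × A × S)) (o : Option (S × A)) :
    ENNReal.ofReal (alg.queryReal h o) = alg.query h o :=
  ENNReal.ofReal_toReal ((alg.query h).apply_ne_top o)

lemma sum_queryReal [Fintype S] [Fintype A] (alg : Algorithm S A) (h : List (S × A × S)) :
    ∑ s, ∑ a, alg.queryReal h (some (s, a)) = 1 - alg.queryReal h none := by
  have h1 : ∑ o, alg.queryReal h o = 1 := by
    have := (alg.query h).tsum_coe
    rw [tsum_fintype] at this
    simp only [queryReal]
    rw [← ENNReal.toReal_sum fun o _ => (alg.query h).apply_ne_top o, this, ENNReal.toReal_one]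
  rw [Fintype.sum_option, Fintype.sum_prod_type] at h1
  linarith

/-- The log-likelihood ratio of a history between two models. -/
def logRatio (P₀ P₁ : S → A → S → ℝ) : List (S × A × S) → ℝ
  | [] => 0
  | (s, a, s') :: h => logRatio P₀ P₁ h + Real.log (P₀ s a s' / P₁ s a s')

/-- The probability that the output lies in `B` given that the algorithm stopped at `h`. -/
def outputReal (alg : Algorithm S A) (B : Set (S → ℝ)) (h : List (S × A × S)) : ℝ :=
  (alg.output h B).toReal

lemma output_le_one (alg : Algorithm S A) (B : Set (S → ℝ)) (h : List (S × A × S)) :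
    alg.output h B ≤ 1 :=
  have := alg.output_prob h
  prob_le_one

lemma ofReal_outputReal (alg : Algorithm S A) (B : Set (S → ℝ)) (h : List (S × A × S)) :
    ENNReal.ofReal (alg.outputReal B h) = alg.output h B :=
  ENNReal.ofReal_toReal ((alg.output_le_one B h).trans_lt ENNReal.one_lt_top).ne

lemma outputReal_nonneg (alg : Algorithm S A) (B : Set (S → ℝ)) (h : List (S × A × S)) :
    0 ≤ alg.outputReal B h := ENNReal.toReal_nonneg

lemma outputReal_le_one (alg : Algorithm S A) (B : Set (S → ℝ)) (h : List (S × A × S)) :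
    alg.outputReal B h ≤ 1 := by
  rw [outputReal, ← ENNReal.toReal_one]
  exact ENNReal.toReal_mono ENNReal.one_ne_top (alg.output_le_one B h)

variable [Fintype S]

lemma reach_nonneg (alg : Algorithm S A) {P : S → A → S → ℝ} (hP : IsTransition P)
    (h : List (S × A × S)) : 0 ≤ alg.reach P h := by
  induction h with
  | nil => exact zero_le_one
  | cons x h ih =>
    exact mul_nonneg (mul_nonneg ih (alg.queryReal_nonneg _ _)) ((hP x.1 x.2.1).1 x.2.2)

lemma ofReal_reach (alg : Algorithm S A) {P : S → A → S → ℝ} (hP : IsTransition P)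
    (h : List (S × A × S)) : ENNReal.ofReal (alg.reach P h) = alg.reachProb P h := by
  induction h with
  | nil => exact ENNReal.ofReal_one
  | cons x h ih =>
    obtain ⟨s, a, s'⟩ := x
    rw [reach, reachProb, ENNReal.ofReal_mul
      (mul_nonneg (alg.reach_nonneg hP h) (alg.queryReal_nonneg _ _)),
      ENNReal.ofReal_mul (alg.reach_nonneg hP h), ih, ofReal_queryReal]

/-- The query probabilities are the same under both models and cancel in the likelihood ratio.
Common support keeps each factor of the ratio meaningful; where both probabilities vanish the value
of the logarithm is irrelevant. -/
lemma reach_eq_mul_exp (alg : Algorithm S A) {P₀ P₁ : S → A → S → ℝ} (hP₀ : IsTransition P₀)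
    (hP₁ : IsTransition P₁) (hsupp : ∀ s a s', P₀ s a s' = 0 ↔ P₁ s a s' = 0)
    (h : List (S × A × S)) :
    alg.reach P₁ h = alg.reach P₀ h * Real.exp (-logRatio P₀ P₁ h) := by
  induction h with
  | nil => simp [reach, logRatio]
  | cons x h ih =>
    obtain ⟨s, a, s'⟩ := x
    have key : P₁ s a s' = P₀ s a s' * Real.exp (-Real.log (P₀ s a s' / P₁ s a s')) := by
      by_cases h0 : P₀ s a s' = 0
      · rw [h0, (hsupp s a s').1 h0, zero_mul]
      · have h1 := (hsupp s a s').not.1 h0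
        have h0' := lt_of_le_of_ne ((hP₀ s a).1 s') (Ne.symm h0)
        have h1' := lt_of_le_of_ne ((hP₁ s a).1 s') (Ne.symm h1)
        rw [Real.exp_neg, Real.exp_log (div_pos h0' h1')]
        field_simp
    rw [reach, reach, logRatio, ih, neg_add, Real.exp_add]
    conv_lhs => rw [key]
    ring

variable [Fintype A]

/-- The tower property for one more sample; it drives the inductions on the truncation time. -/
lemma sum_level_succ (alg : Algorithm S A) (P : S → A → S → ℝ) (F : List (S × A × S) → ℝ)
    (n : ℕ) :
    ∑ v : List.Vector (S × A × S) (n + 1), alg.reach P v.toList * F v.toList =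
      ∑ v : List.Vector (S × A × S) n, alg.reach P v.toList * ∑ s, ∑ a,
        alg.queryReal v.toList (some (s, a)) * ∑ s', P s a s' * F ((s, a, s') :: v.toList) := by
  rw [sum_vector_succ n fun h => alg.reach P h * F h]
  refine Finset.sum_congr rfl fun v _ => ?_
  simp only [Fintype.sum_prod_type, Finset.mul_sum, reach]
  exact Finset.sum_congr rfl fun s _ => Finset.sum_congr rfl fun a _ =>
    Finset.sum_congr rfl fun s' _ => by ring

/-- The probability of stopping after exactly `n` samples, weighted with `F`. -/
def stopMean (alg : Algorithm S A) (P : S → A → S → ℝ) (F : List (S × A × S) → ℝ) (n : ℕ) : ℝ :=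
  ∑ v : List.Vector (S × A × S) n, alg.reach P v.toList * (alg.queryReal v.toList none * F v.toList)

/-- The probability that sample number `n + 1` is drawn and is one of `(s, a)`. -/
def queryMean (alg : Algorithm S A) (P : S → A → S → ℝ) (s : S) (a : A) (n : ℕ) : ℝ :=
  ∑ v : List.Vector (S × A × S) n, alg.reach P v.toList * alg.queryReal v.toList (some (s, a))

lemma sum_stopMean_one_add (alg : Algorithm S A) {P : S → A → S → ℝ} (hP : IsTransition P)
    (T : ℕ) : ∑ t ∈ Finset.range T, alg.stopMean P (fun _ => 1) t
      + ∑ v : List.Vector (S × A × S) T, alg.reach P v.toList = 1 := by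
  induction T with
  | zero => simp [reach]
  | succ T ih =>
    have h := alg.sum_level_succ P (fun _ => 1) T
    simp only [mul_one, (hP _ _).2, sum_queryReal, mul_sub, Finset.sum_sub_distrib] at h
    have hs : alg.stopMean P (fun _ => 1) T =
        ∑ v : List.Vector (S × A × S) T, alg.reach P v.toList * alg.queryReal v.toList none := by
      simp only [stopMean, mul_one]
    rw [Finset.sum_range_succ, h, hs]
    linarith

/-- Wald's identity for the log-likelihood ratio of models that differ in one pair only. -/
lemma sum_stopMean_logRatio_add (alg : Algorithm S A) {P₀ P₁ : S → A → S → ℝ}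
    (hP₀ : IsTransition P₀) {s₁ : S} {a₁ : A}
    (hagree : ∀ s a, (s, a) ≠ (s₁, a₁) → P₀ s a = P₁ s a) (T : ℕ) :
    ∑ t ∈ Finset.range T, alg.stopMean P₀ (logRatio P₀ P₁) t
      + ∑ v : List.Vector (S × A × S) T, alg.reach P₀ v.toList * logRatio P₀ P₁ v.toList =
    (∑ s', P₀ s₁ a₁ s' * Real.log (P₀ s₁ a₁ s' / P₁ s₁ a₁ s')) *
      ∑ t ∈ Finset.range T, alg.queryMean P₀ s₁ a₁ t := by
  set κ := ∑ s', P₀ s₁ a₁ s' * Real.log (P₀ s₁ a₁ s' / P₁ s₁ a₁ s') with hκ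
  induction T with
  | zero =>
    simp [logRatio]
  | succ T ih =>
    -- A sample of a pair on which the models agree has zero expected log-likelihood increment, so
    -- only queries of `(s₁, a₁)` are counted.
    have hpair : ∀ s a, (s, a) ≠ (s₁, a₁) →
        ∑ s', P₀ s a s' * Real.log (P₀ s a s' / P₁ s a s') = 0 := by
      intro s a hsa
      refine Finset.sum_eq_zero fun s' _ => ?_
      rw [hagree s a hsa]
      rcases eq_or_ne (P₁ s a s') 0 with h | h
      · simp [h]
      · simp [div_self h]
    have hstep : ∀ v : List (S × A × S), ∑ s, ∑ a, alg.queryReal v (some (s, a)) *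
        ∑ s', P₀ s a s' * logRatio P₀ P₁ ((s, a, s') :: v) =
        logRatio P₀ P₁ v - alg.queryReal v none * logRatio P₀ P₁ v
          + κ * alg.queryReal v (some (s₁, a₁)) := by
      intro v
      have e1 : ∀ s a, ∑ s', P₀ s a s' * logRatio P₀ P₁ ((s, a, s') :: v) =
          logRatio P₀ P₁ v + ∑ s', P₀ s a s' * Real.log (P₀ s a s' / P₁ s a s') := by
        intro s a
        simp only [logRatio, mul_add, Finset.sum_add_distrib, ← Finset.sum_mul, (hP₀ s a).2,
          one_mul]
      have e2 : ∑ s, ∑ a, alg.queryReal v (some (s, a)) *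
          ∑ s', P₀ s a s' * Real.log (P₀ s a s' / P₁ s a s') =
          κ * alg.queryReal v (some (s₁, a₁)) := by
        rw [← Fintype.sum_prod_type', Fintype.sum_eq_single (s₁, a₁)]
        · rw [mul_comm]
        · rintro ⟨s, a⟩ hsa
          rw [hpair s a hsa, mul_zero]
      simp only [e1, mul_add, Finset.sum_add_distrib, e2, ← Finset.sum_mul, sum_queryReal]
      ring
    have h := alg.sum_level_succ P₀ (logRatio P₀ P₁) T
    simp only [hstep, mul_add, mul_sub, Finset.sum_add_distrib, Finset.sum_sub_distrib] at h
    rw [Finset.sum_range_succ, Finset.sum_range_succ, h, mul_add, ← ih, stopMean, queryMean]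
    have e3 : ∑ v : List.Vector (S × A × S) T,
        alg.reach P₀ v.toList * (κ * alg.queryReal v.toList (some (s₁, a₁))) =
        κ * ∑ v : List.Vector (S × A × S) T,
          alg.reach P₀ v.toList * alg.queryReal v.toList (some (s₁, a₁)) := by
      rw [Finset.mul_sum]
      exact Finset.sum_congr rfl fun v _ => by ring
    rw [e3]
    ring

lemma stopMean_nonneg (alg : Algorithm S A) {P : S → A → S → ℝ} (hP : IsTransition P)
    {F : List (S × A × S) → ℝ} (hF : ∀ h, 0 ≤ F h) (n : ℕ) : 0 ≤ alg.stopMean P F n :=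
  Finset.sum_nonneg fun _ _ => mul_nonneg (alg.reach_nonneg hP _)
    (mul_nonneg (alg.queryReal_nonneg _ _) (hF _))

lemma queryMean_nonneg (alg : Algorithm S A) {P : S → A → S → ℝ} (hP : IsTransition P)
    (s : S) (a : A) (n : ℕ) : 0 ≤ alg.queryMean P s a n :=
  Finset.sum_nonneg fun _ _ => mul_nonneg (alg.reach_nonneg hP _) (alg.queryReal_nonneg _ _)

lemma outputProb_eq_tsum (alg : Algorithm S A) {P : S → A → S → ℝ} (hP : IsTransition P)
    (B : Set (S → ℝ)) :
    alg.outputProb P B = ∑' n, ENNReal.ofReal (alg.stopMean P (alg.outputReal B) n) := by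
  rw [outputProb, tsum_list_eq]
  refine tsum_congr fun n => ?_
  rw [stopMean, ENNReal.ofReal_sum_of_nonneg fun v _ => mul_nonneg (alg.reach_nonneg hP _)
    (mul_nonneg (alg.queryReal_nonneg _ _) (alg.outputReal_nonneg _ _))]
  refine Finset.sum_congr rfl fun v _ => ?_
  rw [ENNReal.ofReal_mul (alg.reach_nonneg hP _), ENNReal.ofReal_mul (alg.queryReal_nonneg _ _),
    ofReal_reach alg hP, ofReal_queryReal, ofReal_outputReal, mul_assoc]

lemma outputProb_univ_le_one (alg : Algorithm S A) {P : S → A → S → ℝ} (hP : IsTransition P) :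
    alg.outputProb P Set.univ ≤ 1 := by
  rw [outputProb_eq_tsum alg hP]
  refine ENNReal.tsum_le_of_sum_range_le fun T => ?_
  have h1 : alg.outputReal Set.univ = fun _ => 1 := by
    funext h
    have := alg.output_prob h
    simp [outputReal]
  rw [← ENNReal.ofReal_sum_of_nonneg fun t _ =>
    alg.stopMean_nonneg hP (alg.outputReal_nonneg _) t, h1, ← ENNReal.ofReal_one]
  exact ENNReal.ofReal_le_ofReal ((le_add_of_nonneg_right
    (Finset.sum_nonneg fun v _ => alg.reach_nonneg hP _)).trans (alg.sum_stopMean_one_add hP T).le)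

/-- Only an inequality, since the algorithm may fail to stop with positive probability. -/
lemma outputProb_add_le_one (alg : Algorithm S A) {P : S → A → S → ℝ} (hP : IsTransition P)
    {B B' : Set (S → ℝ)} (hB : Disjoint B B') (hB' : MeasurableSet B') :
    alg.outputProb P B + alg.outputProb P B' ≤ 1 := by
  refine le_trans ?_ (alg.outputProb_univ_le_one hP)
  rw [outputProb, outputProb, outputProb, ← ENNReal.tsum_add]
  refine ENNReal.tsum_le_tsum fun h => ?_
  rw [← mul_add, ← measure_union hB hB']
  exact mul_le_mul_right (measure_mono (Set.subset_univ _)) _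

/-- The expected number of samples of the pair `(s, a)`. -/
def expectedQueries (alg : Algorithm S A) (P : S → A → S → ℝ) (s : S) (a : A) : ℝ≥0∞ :=
  ∑' n, ENNReal.ofReal (alg.queryMean P s a n)

lemma expectedSamples_eq_sum (alg : Algorithm S A) {P : S → A → S → ℝ} (hP : IsTransition P) :
    alg.expectedSamples P = ∑ s, ∑ a, alg.expectedQueries P s a := by
  have h1 : ∀ n, ∑' h : {h : List (S × A × S) // h.length = n + 1}, alg.reachProb P h =
      ∑ s, ∑ a, ENNReal.ofReal (alg.queryMean P s a n) := by
    intro n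
    have e : ∑' h : {h : List (S × A × S) // h.length = n + 1}, alg.reachProb P h =
        ∑ v : List.Vector (S × A × S) (n + 1), alg.reachProb P v.toList :=
      tsum_fintype (L := .unconditional _)
        (fun v : List.Vector (S × A × S) (n + 1) => alg.reachProb P v.toList)
    have e' := alg.sum_level_succ P (fun _ => 1) n
    simp only [mul_one, (hP _ _).2] at e'
    rw [e]
    simp only [← ofReal_reach alg hP]
    rw [← ENNReal.ofReal_sum_of_nonneg fun v _ => alg.reach_nonneg hP _, e']
    simp only [Finset.mul_sum]
    rw [Finset.sum_comm, ENNReal.ofReal_sum_of_nonneg fun s _ => Finset.sum_nonneg fun v _ =>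
      Finset.sum_nonneg fun a _ => mul_nonneg (alg.reach_nonneg hP _) (alg.queryReal_nonneg _ _)]
    refine Finset.sum_congr rfl fun s _ => ?_
    rw [Finset.sum_comm]
    exact ENNReal.ofReal_sum_of_nonneg fun a _ => alg.queryMean_nonneg hP s a n
  simp only [expectedSamples, h1, expectedQueries]
  rw [Summable.tsum_finsetSum fun _ _ => ENNReal.summable]
  exact Finset.sum_congr rfl fun s _ => Summable.tsum_finsetSum fun _ _ => ENNReal.summable

/-- Distinguishing two models that differ in one pair only requires sampling this pair. -/
theorem le_expectedQueries (alg : Algorithm S A) {P₀ P₁ : S → A → S → ℝ}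
    (hP₀ : IsTransition P₀) (hP₁ : IsTransition P₁)
    (hsupp : ∀ s a s', P₀ s a s' = 0 ↔ P₁ s a s' = 0) {s₁ : S} {a₁ : A}
    (hagree : ∀ s a, (s, a) ≠ (s₁, a₁) → P₀ s a = P₁ s a) {κ : ℝ} (hκ0 : 0 < κ)
    (hκ : ∑ s', P₀ s₁ a₁ s' * Real.log (P₀ s₁ a₁ s' / P₁ s₁ a₁ s') ≤ κ)
    {B B' : Set (S → ℝ)} (hBB' : Disjoint B B') (hB' : MeasurableSet B')
    (h₀ : ENNReal.ofReal (3 / 4) ≤ alg.outputProb P₀ B)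
    (h₁ : ENNReal.ofReal (3 / 4) ≤ alg.outputProb P₁ B') :
    ENNReal.ofReal (2 / (5 * κ)) ≤ alg.expectedQueries P₀ s₁ a₁ := by
  set o := alg.outputReal B with ho
  have hlog : 1 ≤ Real.log 3 := by
    rw [Real.le_log_iff_exp_le (by norm_num)]
    linarith [Real.exp_one_lt_d9]
  have hb1 : ∀ T, ∑ t ∈ Finset.range T, alg.stopMean P₁ o t ≤ 1 / 4 := by
    intro T
    have h2 := alg.outputProb_add_le_one hP₁ hBB' hB'
    have h3 : alg.outputProb P₁ B + ENNReal.ofReal (3 / 4) ≤ 1 :=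
      (add_le_add le_rfl h₁).trans h2
    have h4 : ENNReal.ofReal (∑ t ∈ Finset.range T, alg.stopMean P₁ o t) ≤
        alg.outputProb P₁ B := by
      rw [outputProb_eq_tsum alg hP₁, ENNReal.ofReal_sum_of_nonneg fun t _ =>
        alg.stopMean_nonneg hP₁ (alg.outputReal_nonneg B) t]
      exact ENNReal.sum_le_tsum _
    have h5 := (add_le_add h4 (le_refl (ENNReal.ofReal (3 / 4)))).trans h3
    rw [← ENNReal.ofReal_add (Finset.sum_nonneg fun t _ =>
      alg.stopMean_nonneg hP₁ (alg.outputReal_nonneg B) t) (by norm_num),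
      ENNReal.ofReal_le_one] at h5
    linarith
  -- Truncation at a finite time keeps all sums finite; lowering `3/4` to `7/10` leaves room for it.
  obtain ⟨T, hT⟩ : ∃ T, 7 / 10 < ∑ t ∈ Finset.range T, alg.stopMean P₀ o t := by
    have h2 : ENNReal.ofReal (7 / 10) < alg.outputProb P₀ B :=
      lt_of_lt_of_le ((ENNReal.ofReal_lt_ofReal_iff (by norm_num)).2 (by norm_num)) h₀
    rw [outputProb_eq_tsum alg hP₀, ENNReal.tsum_eq_iSup_nat, lt_iSup_iff] at h2
    obtain ⟨T, hT⟩ := h2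
    refine ⟨T, ?_⟩
    rw [← ENNReal.ofReal_sum_of_nonneg fun t _ =>
      alg.stopMean_nonneg hP₀ (alg.outputReal_nonneg B) t] at hT
    exact (ENNReal.ofReal_lt_ofReal_iff_of_nonneg (by norm_num)).1 hT
  -- `1 + u ≤ exp u` at `u = -logRatio - log c`: a tangent bound for the relative entropy, sharp
  -- where the likelihood ratio `P₁/P₀` equals `c`.
  have htan : ∀ (h : List (S × A × S)) (c : ℝ), 0 < c →
      alg.reach P₀ h * (1 - Real.log c) - alg.reach P₁ h / c ≤
        alg.reach P₀ h * logRatio P₀ P₁ h := by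
    intro h c hc
    have e : Real.exp (-logRatio P₀ P₁ h) / c =
        Real.exp (-logRatio P₀ P₁ h - Real.log c) := by
      rw [Real.exp_sub, Real.exp_log hc]
    rw [reach_eq_mul_exp alg hP₀ hP₁ hsupp, mul_div_assoc, e]
    have := mul_le_mul_of_nonneg_left
      (Real.add_one_le_exp (-logRatio P₀ P₁ h - Real.log c)) (alg.reach_nonneg hP₀ h)
    linarith
  -- Use `c = 1/3` with weight `o h`, where the output lies in `B`, and `c = 3` with weight `1 - o
  -- h`. The value 3 is the ratio of `3/4` to `1/4`.
  have hpt : ∀ h, alg.reach P₀ h * (1 - Real.log 3) - alg.reach P₁ h / 3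
      + o h * (2 * Real.log 3 * alg.reach P₀ h - 8 / 3 * alg.reach P₁ h) ≤
      alg.reach P₀ h * logRatio P₀ P₁ h := by
    intro h
    have h3 := htan h 3 (by norm_num)
    have h4 := htan h (1 / 3) (by norm_num)
    rw [one_div, Real.log_inv] at h4
    have h5 := mul_le_mul_of_nonneg_left h4 (alg.outputReal_nonneg B h)
    have h6 := mul_le_mul_of_nonneg_left h3 (sub_nonneg.2 (alg.outputReal_le_one B h))
    rw [← ho] at h5 h6
    have e : alg.reach P₁ h / (3 : ℝ)⁻¹ = 3 * alg.reach P₁ h := by field_simp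
    rw [e] at h5
    linarith
  have hS : ∀ t, (1 - Real.log 3) * alg.stopMean P₀ (fun _ => 1) t
      - 1 / 3 * alg.stopMean P₁ (fun _ => 1) t
      + 2 * Real.log 3 * alg.stopMean P₀ o t - 8 / 3 * alg.stopMean P₁ o t ≤
      alg.stopMean P₀ (logRatio P₀ P₁) t := by
    intro t
    simp only [stopMean, Finset.mul_sum, ← Finset.sum_sub_distrib, ← Finset.sum_add_distrib]
    refine Finset.sum_le_sum fun v _ => ?_
    have := mul_le_mul_of_nonneg_left (hpt v.toList) (alg.queryReal_nonneg v.toList none)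
    linarith
  have hK : (1 - Real.log 3) * ∑ v : List.Vector (S × A × S) T, alg.reach P₀ v.toList
      - 1 / 3 * ∑ v : List.Vector (S × A × S) T, alg.reach P₁ v.toList ≤
      ∑ v : List.Vector (S × A × S) T, alg.reach P₀ v.toList * logRatio P₀ P₁ v.toList := by
    simp only [Finset.mul_sum, ← Finset.sum_sub_distrib]
    refine Finset.sum_le_sum fun v _ => ?_
    linarith [htan v.toList 3 (by norm_num)]
  have hSs := Finset.sum_le_sum fun t (_ : t ∈ Finset.range T) => hS t
  simp only [Finset.sum_sub_distrib, Finset.sum_add_distrib, ← Finset.mul_sum] at hSs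
  have hw := alg.sum_stopMean_logRatio_add (P₁ := P₁) hP₀ hagree T
  have hm0 := alg.sum_stopMean_one_add hP₀ T
  have hm1 := alg.sum_stopMean_one_add hP₁ T
  have hN : 0 ≤ ∑ t ∈ Finset.range T, alg.queryMean P₀ s₁ a₁ t :=
    Finset.sum_nonneg fun t _ => alg.queryMean_nonneg hP₀ _ _ t
  -- The truncated relative entropy is at least `(1 - log 3) - 1/3 + 2 log 3 · 7/10 - 8/3 · 1/4 =
  -- (2/5) log 3`, and `log 3 ≥ 1`.
  have hmain : 2 / 5 ≤ κ * ∑ t ∈ Finset.range T, alg.queryMean P₀ s₁ a₁ t := by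
    have h2 := mul_le_mul_of_nonneg_right hκ hN
    have h3 := mul_le_mul_of_nonneg_left hT.le (by linarith : 0 ≤ 2 * Real.log 3)
    have h4 := hb1 T
    have h5 : (1 - Real.log 3) * ∑ t ∈ Finset.range T, alg.stopMean P₀ (fun _ => 1) t +
        (1 - Real.log 3) * ∑ v : List.Vector (S × A × S) T, alg.reach P₀ v.toList =
        1 - Real.log 3 := by rw [← mul_add, hm0, mul_one]
    linarith
  calc ENNReal.ofReal (2 / (5 * κ)) ≤
        ENNReal.ofReal (∑ t ∈ Finset.range T, alg.queryMean P₀ s₁ a₁ t) := by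
        refine ENNReal.ofReal_le_ofReal ?_
        rw [div_le_iff₀ (by linarith)]
        linarith
    _ = ∑ t ∈ Finset.range T, ENNReal.ofReal (alg.queryMean P₀ s₁ a₁ t) :=
        ENNReal.ofReal_sum_of_nonneg fun t _ => alg.queryMean_nonneg hP₀ _ _ t
    _ ≤ _ := ENNReal.sum_le_tsum _

end Algorithm

/-! ### The escape model and its robust value. -/

section HardModel

/-- The robust expectation of a function with values `v` and `0` on a two-point set whose second
point has nominal mass `θ`. -/
def twoPointExp (lam θ v : ℝ) : ℝ := (1 - θ) * v - v ^ 2 * (θ * (1 - θ)) / (4 * lam)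

/-- From `s` one stays at `s` with probability `1 - θ s a` and else moves to `s₀`. -/
def escapeModel {S A : Type*} (s₀ : S) (θ : S → A → ℝ) : S → A → S → ℝ := fun s a s' =>
  open scoped Classical in
  (1 - θ s a) * (if s' = s then 1 else 0) + θ s a * (if s' = s₀ then 1 else 0)

/-- The reward is `1` outside of `s₀`. -/
def escapeReward {S A : Type*} (s₀ : S) : S → A → ℝ := fun s _ =>
  open scoped Classical in if s = s₀ then 0 else 1

variable {S A : Type*} {s₀ : S} {θ : S → A → ℝ}

lemma escapeModel_self {s : S} (hs : s ≠ s₀) (a : A) : escapeModel s₀ θ s a s = 1 - θ s a := by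
  simp [escapeModel, hs]

lemma escapeModel_sink {s : S} (hs : s ≠ s₀) (a : A) : escapeModel s₀ θ s a s₀ = θ s a := by
  simp [escapeModel, hs.symm]

lemma escapeModel_other {s s' : S} (a : A) (h : s' ≠ s) (h₀ : s' ≠ s₀) :
    escapeModel s₀ θ s a s' = 0 := by
  simp [escapeModel, h, h₀]

lemma escapeModel_eq_zero_iff (hθ : ∀ s a, θ s a ∈ Set.Ioo (0 : ℝ) 1) (s : S) (a : A) (s' : S) :
    escapeModel s₀ θ s a s' = 0 ↔ s' ≠ s ∧ s' ≠ s₀ := by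
  have h1 := (hθ s a).1
  have h2 := sub_pos.2 (hθ s a).2
  rcases eq_or_ne s' s with rfl | h
  · refine iff_of_false (ne_of_gt ?_) fun hh => hh.1 rfl
    unfold escapeModel
    split_ifs <;> first | linarith | contradiction
  · rcases eq_or_ne s' s₀ with rfl | h'
    · refine iff_of_false (ne_of_gt ?_) fun hh => hh.2 rfl
      unfold escapeModel
      split_ifs <;> first | linarith | contradiction
    · exact iff_of_true (escapeModel_other a h h') ⟨h, h'⟩

lemma escapeReward_mem (s : S) (a : A) : escapeReward (A := A) s₀ s a ∈ Set.Icc (0 : ℝ) 1 := by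
  unfold escapeReward
  split_ifs <;> simp

variable [Fintype S]

lemma isTransition_escapeModel (hθ : ∀ s a, θ s a ∈ Set.Ioo (0 : ℝ) 1) :
    IsTransition (escapeModel s₀ θ) := by
  classical
  intro s a
  have h1 := (hθ s a).1.le
  have h2 := sub_nonneg.2 (hθ s a).2.le
  refine ⟨fun s' => ?_, ?_⟩
  · refine add_nonneg (mul_nonneg h2 ?_) (mul_nonneg h1 ?_) <;> split_ifs <;> norm_num
  · simp [escapeModel, Finset.sum_add_distrib]

/-- On two points the problem is a quadratic in the mass `q` kept at `s`. The condition `V s * θ s a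
≤ 2 * lam` says that its unconstrained minimizer `p (1 - V s θ / (2 lam))` is nonnegative, so that
the closed formula is valid. -/
lemma robustExp_escapeModel {lam : ℝ} (hl : 0 < lam) (hθ : ∀ s a, θ s a ∈ Set.Ioo (0 : ℝ) 1)
    {V : S → ℝ} (hV₀ : V s₀ = 0) {s : S} (hs : s ≠ s₀) (a : A) (hV : 0 ≤ V s)
    (hVθ : V s * θ s a ≤ 2 * lam) :
    robustExp lam (escapeModel s₀ θ s a) V = twoPointExp lam (θ s a) (V s) := by
  classical
  have hP := isTransition_escapeModel (s₀ := s₀) hθ s a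
  have h0 := (hθ s a).1
  have h1 := sub_pos.2 (hθ s a).2
  set p := 1 - θ s a with hp
  have key : ∀ Q ∈ stdSimplex ℝ S, (∀ x, escapeModel s₀ θ s a x = 0 → Q x = 0) →
      penalizedExp lam (escapeModel s₀ θ s a) V Q =
        Q s * V s + lam * ((Q s - p) ^ 2 / (θ s a * p)) := by
    intro Q hQ hQP
    have hQ0 : ∀ x, x ≠ s ∧ x ≠ s₀ → Q x = 0 := fun x hx =>
      hQP x (escapeModel_other a hx.1 hx.2)
    have hQ1 : Q s + Q s₀ = 1 := by
      rw [← hQ.2]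
      exact (Finset.sum_eq_add s s₀ hs (fun x _ hx => hQ0 x hx) (by simp) (by simp)).symm
    have e1 : ∑ x, Q x * V x = Q s * V s := by
      rw [Finset.sum_eq_add s s₀ hs (fun x _ hx => by rw [hQ0 x hx, zero_mul]) (by simp)
        (by simp), hV₀, mul_zero, add_zero]
    rw [penalizedExp, e1, Finset.sum_eq_add s s₀ hs
      (fun x _ hx => by rw [escapeModel_other a hx.1 hx.2, mul_zero]) (by simp) (by simp),
      escapeModel_self hs, escapeModel_sink hs, ← hp, eq_sub_of_add_eq' hQ1, chiSq, chiSq]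
    have hθp : θ s a = 1 - p := by rw [hp]; ring
    rw [hθp] at h0 ⊢
    congr 2
    field_simp
    ring
  have sq : ∀ q, q * V s + lam * ((q - p) ^ 2 / (θ s a * p)) = twoPointExp lam (θ s a) (V s) +
      lam / (θ s a * p) * (q - p + V s * (θ s a * p) / (2 * lam)) ^ 2 := by
    intro q
    rw [twoPointExp, ← hp]
    field_simp
    ring
  refine le_antisymm ?_ ?_
  · set q := p - V s * (θ s a * p) / (2 * lam) with hq
    have hr0 : 0 ≤ V s * θ s a / (2 * lam) := by positivity
    have hr1 : V s * θ s a / (2 * lam) ≤ 1 := by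
      rw [div_le_one (by linarith)]
      exact hVθ
    have hq' : q = p * (1 - V s * θ s a / (2 * lam)) := by rw [hq]; ring
    have hq0 : 0 ≤ q := by rw [hq']; exact mul_nonneg h1.le (by linarith)
    have hq1 : q ≤ 1 := by
      rw [hq']
      exact mul_le_one₀ (by linarith) (by linarith) (by linarith)
    let Q : S → ℝ := fun x => q * (if x = s then 1 else 0) + (1 - q) * (if x = s₀ then 1 else 0)
    have hQ : Q ∈ stdSimplex ℝ S := by
      refine ⟨fun x => ?_, by simp [Q, Finset.sum_add_distrib]⟩
      refine add_nonneg (mul_nonneg hq0 ?_) (mul_nonneg (by linarith) ?_) <;> split_ifs <;>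
        norm_num
    have hQP : ∀ x, escapeModel s₀ θ s a x = 0 → Q x = 0 := by
      intro x hx
      have := (escapeModel_eq_zero_iff hθ s a x).1 hx
      simp [Q, this.1, this.2]
    have hQs : Q s = q := by simp [Q, hs]
    refine (robustExp_le hl V hP hQ hQP).trans (le_of_eq ?_)
    rw [key Q hQ hQP, sq, hQs, hq]
    ring
  · obtain ⟨Q, hQ, hQP, h⟩ := exists_robustExp_eq hl V hP
    rw [h, key Q hQ hQP, sq]
    exact le_add_of_nonneg_right (by positivity)

lemma robustExp_escapeModel_sink {lam : ℝ} (hl : 0 < lam)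
    (hθ : ∀ s a, θ s a ∈ Set.Ioo (0 : ℝ) 1) {V : S → ℝ} (hV₀ : V s₀ = 0) (a : A) :
    robustExp lam (escapeModel s₀ θ s₀ a) V = 0 := by
  have hP := isTransition_escapeModel (s₀ := s₀) hθ s₀ a
  have key : ∀ Q : S → ℝ, (∀ x, escapeModel s₀ θ s₀ a x = 0 → Q x = 0) →
      ∑ x, Q x * V x = 0 := by
    intro Q hQP
    refine Finset.sum_eq_zero fun x _ => ?_
    rcases eq_or_ne x s₀ with h | h
    · rw [h, hV₀, mul_zero]
    · rw [hQP x (escapeModel_other a h h), zero_mul]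
  refine le_antisymm ?_ ?_
  · refine (robustExp_le hl V hP hP fun x hx => hx).trans (le_of_eq ?_)
    rw [penalizedExp, key _ fun x hx => hx, penalty_self, mul_zero, add_zero]
  · obtain ⟨Q, hQ, hQP, h⟩ := exists_robustExp_eq hl V hP
    rw [h, penalizedExp, key Q hQP, zero_add]
    exact mul_nonneg hl.le (penalty_nonneg hP Q)

lemma isBellman_escapeModel {lam γ : ℝ} (hl : 0 < lam) (hθ : ∀ s a, θ s a ∈ Set.Ioo (0 : ℝ) 1)
    [Nonempty A] {V : S → ℝ} (hV₀ : V s₀ = 0) (hV : ∀ s, 0 ≤ V s)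
    (hVθ : ∀ s a, V s * θ s a ≤ 2 * lam)
    (hle : ∀ s, s ≠ s₀ → ∀ a, 1 + γ * twoPointExp lam (θ s a) (V s) ≤ V s)
    (heq : ∀ s, s ≠ s₀ → ∃ a, V s = 1 + γ * twoPointExp lam (θ s a) (V s)) :
    IsBellman lam γ (escapeReward s₀) (escapeModel s₀ θ) V := by
  constructor
  · intro s a
    rcases eq_or_ne s s₀ with rfl | hs
    · rw [robustExp_escapeModel_sink hl hθ hV₀, hV₀]
      simp [escapeReward]
    · rw [robustExp_escapeModel hl hθ hV₀ hs a (hV s) (hVθ s a)]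
      simpa [escapeReward, hs] using hle s hs a
  · intro s
    rcases eq_or_ne s s₀ with rfl | hs
    · refine ⟨Classical.arbitrary A, ?_⟩
      rw [robustExp_escapeModel_sink hl hθ hV₀, hV₀]
      simp [escapeReward]
    · obtain ⟨a, ha⟩ := heq s hs
      refine ⟨a, ?_⟩
      rw [robustExp_escapeModel hl hθ hV₀ hs a (hV s) (hVθ s a)]
      simpa [escapeReward, hs] using ha.le

/-- The relative entropy is at most the `χ²`-divergence. -/
lemma sum_log_escapeModel_le {θ' : S → A → ℝ} (hθ : ∀ s a, θ s a ∈ Set.Ioo (0 : ℝ) 1)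
    (hθ' : ∀ s a, θ' s a ∈ Set.Ioo (0 : ℝ) 1) {s : S} (hs : s ≠ s₀) (a : A) :
    ∑ s', escapeModel s₀ θ s a s' *
      Real.log (escapeModel s₀ θ s a s' / escapeModel s₀ θ' s a s') ≤
      (θ s a - θ' s a) ^ 2 / (θ' s a * (1 - θ' s a)) := by
  rw [Finset.sum_eq_add s s₀ hs
    (fun x _ hx => by rw [escapeModel_other a hx.1 hx.2, zero_mul]) (by simp) (by simp),
    escapeModel_self hs, escapeModel_self hs, escapeModel_sink hs, escapeModel_sink hs]
  have h0 := (hθ s a).1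
  have h1 := sub_pos.2 (hθ s a).2
  have h0' := (hθ' s a).1
  have h1' := sub_pos.2 (hθ' s a).2
  have e1 := mul_le_mul_of_nonneg_left (Real.log_le_sub_one_of_pos (div_pos h1 h1')) h1.le
  have e2 := mul_le_mul_of_nonneg_left (Real.log_le_sub_one_of_pos (div_pos h0 h0')) h0.le
  refine (add_le_add e1 e2).trans (le_of_eq ?_)
  field_simp
  ring

end HardModel

/-! ### Calibration of the two escape probabilities. -/

section Scalar

/-- The intermediate value theorem also locates the solution above `lo`, which is needed for the
size of `v` and for `v ≤ v'`. -/
lemma exists_fixedPoint_twoPointExp {γ lam θ lo : ℝ} (hγ0 : 0 ≤ γ) (hγ1 : γ < 1) (hl : 0 < lam)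
    (hθ : θ ∈ Set.Icc (0 : ℝ) 1) (hloH : lo ≤ 1 / (1 - γ))
    (h : lo ≤ 1 + γ * twoPointExp lam θ lo) :
    ∃ v ∈ Set.Icc lo (1 / (1 - γ)), v = 1 + γ * twoPointExp lam θ v := by
  have hg : 0 < 1 - γ := by linarith
  have hH : 0 ≤ 1 / (1 - γ) := by positivity
  let G : ℝ → ℝ := fun x => x - (1 + γ * twoPointExp lam θ x)
  have hG : Continuous G := by
    simp only [G, twoPointExp]
    fun_prop
  have h1 : 0 ≤ G (1 / (1 - γ)) := by
    have hF : twoPointExp lam θ (1 / (1 - γ)) ≤ 1 / (1 - γ) := by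
      have e1 : (1 - θ) * (1 / (1 - γ)) ≤ 1 / (1 - γ) :=
        mul_le_of_le_one_left hH (by linarith [hθ.1])
      have e2 : 0 ≤ (1 / (1 - γ)) ^ 2 * (θ * (1 - θ)) / (4 * lam) :=
        div_nonneg (mul_nonneg (sq_nonneg _) (mul_nonneg hθ.1 (sub_nonneg.2 hθ.2))) (by linarith)
      unfold twoPointExp
      linarith
    have e3 := mul_le_mul_of_nonneg_left hF hγ0
    have e4 : 1 / (1 - γ) = 1 + γ * (1 / (1 - γ)) := by field_simp; ring
    change 0 ≤ 1 / (1 - γ) - (1 + γ * twoPointExp lam θ (1 / (1 - γ)))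
    linarith
  obtain ⟨v, hv, hGv⟩ := intermediate_value_Icc hloH hG.continuousOn ⟨sub_nonpos.2 h, h1⟩
  exact ⟨v, hv, sub_eq_zero.1 hGv⟩

set_option maxHeartbeats 1000000 in
/-- Two escape probabilities whose values are more than `2 ε` apart and which are
statistically close. -/
lemma exists_escape_pair {γ lam ε : ℝ} (hγ : 3 / 4 < γ) (hγ1 : γ < 1) (hl : 0 < lam)
    (hε : 0 < ε) (hε1 : ε < 1 / 512) :
    ∃ θ θ' v v' : ℝ, θ ∈ Set.Ioo (0 : ℝ) 1 ∧ θ' ∈ Set.Ioo (0 : ℝ) 1 ∧ θ' ≤ θ ∧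
      0 ≤ v ∧ v + 2 * ε < v' ∧ v' * θ ≤ 2 * lam ∧
      v = 1 + γ * twoPointExp lam θ v ∧ v' = 1 + γ * twoPointExp lam θ' v' ∧
      1 + γ * twoPointExp lam θ v' ≤ v' ∧
      (θ - θ') ^ 2 / (θ' * (1 - θ')) ≤ 2 ^ 20 * ε ^ 2 * (1 - γ) ^ 3 := by
  obtain ⟨g, hgdef⟩ : ∃ g, g = 1 - γ := ⟨_, rfl⟩
  have hγg : γ = 1 - g := by linarith
  have hg : 0 < g := by linarith
  have hg4 : g < 1 / 4 := by linarith
  obtain ⟨m, hm⟩ : ∃ m, m = min lam (1 / g) := ⟨_, rfl⟩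
  have hm0 : 0 < m := by rw [hm]; exact lt_min hl (by positivity)
  have hml : m ≤ lam := hm ▸ min_le_left _ _
  have hmg : m * g ≤ 1 := by
    rw [← le_div_iff₀ hg, hm]; exact min_le_right _ _
  -- The choice gives `θ ≤ g/4` and `θ ≤ lam g²/4`, so neither the leak nor the adversary's
  -- quadratic gain pushes the value below `1/(2g)`.
  obtain ⟨θ, hθ⟩ : ∃ θ, θ = m * g ^ 2 / 4 := ⟨_, rfl⟩
  obtain ⟨D, hD⟩ : ∃ D, D = 256 * ε * m * g ^ 3 := ⟨_, rfl⟩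
  have hθ0 : 0 < θ := by rw [hθ]; positivity
  have hD0 : 0 < D := by rw [hD]; positivity
  have hθg : θ ≤ g / 4 := by
    rw [hθ]
    have := mul_le_mul_of_nonneg_right hmg hg.le
    linarith [this]
  have hθl : θ ≤ lam * g ^ 2 / 4 := by
    rw [hθ]
    gcongr
  -- `D = 1024 ε g θ`, so `ε < 1/512` and `g < 1/4` are exactly what is used here.
  have hDθ : D ≤ θ / 2 := by
    have e1 : D = θ * (1024 * ε * g) := by rw [hD, hθ]; ring
    have e2 : ε * g ≤ 1 / 512 * (1 / 4) := by gcongr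
    rw [e1]
    nlinarith
  obtain ⟨θ', hθ'⟩ : ∃ θ', θ' = θ - D := ⟨_, rfl⟩
  have hθ'0 : θ / 2 ≤ θ' := by linarith
  have hθ'1 : θ' ≤ θ := by linarith
  have hθ'p : 0 < θ' := by linarith
  have hθ1 : θ ≤ 1 / 16 := by linarith
  have hH : 0 < 1 / g := by positivity
  obtain ⟨v, ⟨hv1, hv2⟩, hv⟩ := exists_fixedPoint_twoPointExp (θ := θ) (lo := 1 / (2 * g))
    (by linarith : 0 ≤ γ) hγ1 hl ⟨hθ0.le, by linarith⟩
    (by rw [← hgdef]; gcongr; linarith) (by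
      have e1 : γ * twoPointExp lam θ (1 / (2 * g)) = (1 - θ) * γ * (1 / (2 * g)) -
          γ * (1 - θ) * (θ / (lam * g ^ 2)) / 16 := by
        unfold twoPointExp
        field_simp
        ring
      have e2 : θ / (lam * g ^ 2) ≤ 1 / 4 := by
        rw [div_le_iff₀ (by positivity)]
        linarith
      have e3 : 0 ≤ θ / (lam * g ^ 2) := by positivity
      have e4 : (1 - θ) * γ * (1 / (2 * g)) = 1 / (2 * g) - 1 / 2 - γ * (θ / g) / 2 := by
        rw [hγg]; field_simp
      have e5 : θ / g ≤ 1 / 4 := by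
        rw [div_le_iff₀ hg]; linarith
      have e6 : 0 ≤ θ / g := by positivity
      have e7 : γ * (1 - θ) * (θ / (lam * g ^ 2)) ≤ 1 * (1 / 4) := by
        refine mul_le_mul ?_ e2 e3 zero_le_one
        exact mul_le_one₀ hγ1.le (by linarith) (by linarith)
      have e8 : γ * (θ / g) ≤ 1 * (1 / 4) := mul_le_mul hγ1.le e5 e6 zero_le_one
      rw [e1, e4]
      linarith)
  rw [← hgdef] at hv2
  have hv0 : 0 < v := lt_of_lt_of_le (by positivity) hv1
  have hprod : θ * (1 - θ) - θ' * (1 - θ') = D * (1 - θ - θ') := by rw [hθ']; ring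
  have hmono : ∀ x, 0 ≤ x → D * (x + x ^ 2 / (8 * lam)) ≤
      twoPointExp lam θ' x - twoPointExp lam θ x := by
    intro x hx
    have e1 : twoPointExp lam θ' x - twoPointExp lam θ x =
        D * x + x ^ 2 * (D * (1 - θ - θ')) / (4 * lam) := by
      rw [← hprod, hθ']
      unfold twoPointExp
      field_simp
      ring
    have e2 : D * (x + x ^ 2 / (8 * lam)) = D * x + x ^ 2 * (D * (1 / 2)) / (4 * lam) := by
      field_simp
      ring
    rw [e1, e2]
    gcongr
    linarith
  have hmono' : ∀ x, 0 ≤ x → twoPointExp lam θ x ≤ twoPointExp lam θ' x := by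
    intro x hx
    have := hmono x hx
    have : 0 ≤ D * (x + x ^ 2 / (8 * lam)) := by positivity
    linarith
  have hγ0 : 0 < γ := by linarith
  obtain ⟨v', ⟨hv1', hv2'⟩, hv'⟩ := exists_fixedPoint_twoPointExp (θ := θ') (lo := v)
    hγ0.le hγ1 hl ⟨by linarith, by linarith⟩
    (by rw [← hgdef]; exact hv2) (by
      have := mul_le_mul_of_nonneg_left (hmono' v hv0.le) hγ0.le
      linarith)
  rw [← hgdef] at hv2'
  have hv0' : 0 < v' := hv0.trans_le hv1'
  have hvθ : v' * θ ≤ lam * g / 4 := by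
    calc v' * θ ≤ 1 / g * (lam * g ^ 2 / 4) := by gcongr
      _ = lam * g / 4 := by field_simp
  refine ⟨θ, θ', v, v', ⟨hθ0, by linarith⟩, ⟨by linarith, by linarith⟩, hθ'1, hv0.le, ?_, ?_,
    hv, hv', ?_, ?_⟩
  · have e1 : twoPointExp lam θ' v' - twoPointExp lam θ' v =
        (v' - v) * ((1 - θ') * (1 - (v + v') * θ' / (4 * lam))) := by
      unfold twoPointExp
      field_simp
      ring
    have e2 : (v + v') * θ' / (4 * lam) ≤ g / 8 := by
      rw [div_le_iff₀ (by linarith)]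
      have : (v + v') * θ' ≤ (v' + v') * θ := by gcongr
      linarith
    have e3 : 1 - 3 / 8 * g ≤ (1 - θ') * (1 - (v + v') * θ' / (4 * lam)) := by
      have : (1 - g / 4) * (1 - g / 8) ≤ (1 - θ') * (1 - (v + v') * θ' / (4 * lam)) := by
        gcongr <;> linarith
      nlinarith [sq_nonneg g]
    have e4 := mul_le_mul_of_nonneg_left e3 (sub_nonneg.2 hv1')
    have e5 : 8 * ε * g ≤ D * (v + v ^ 2 / (8 * lam)) := by
      -- If `m = lam` the quadratic term, the adversary's gain, provides the bound; if `m = 1/g` the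
      -- linear term does.
      have e6 : 1 / (32 * g ^ 2) ≤ m * (v + v ^ 2 / (8 * lam)) := by
        rcases min_choice lam (1 / g) with h | h
        · rw [h] at hm
          subst hm
          have : (1 / (2 * g)) ^ 2 ≤ v ^ 2 := by gcongr
          have e7 : m * (v + v ^ 2 / (8 * m)) = m * v + v ^ 2 / 8 := by field_simp
          have e8 : (1 : ℝ) / (32 * g ^ 2) = (1 / (2 * g)) ^ 2 / 8 := by field_simp; norm_num
          rw [e7, e8]
          have := mul_pos hm0 hv0
          linarith
        · rw [h] at hm
          have e7 : 1 / (32 * g ^ 2) ≤ m * (1 / (2 * g)) := by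
            rw [hm]
            have : 1 / g * (1 / (2 * g)) = 1 / (2 * g ^ 2) := by field_simp
            rw [this]
            gcongr
            norm_num
          refine e7.trans ?_
          gcongr
          have : 0 ≤ v ^ 2 / (8 * lam) := by positivity
          linarith
      calc 8 * ε * g = 256 * ε * g ^ 3 * (1 / (32 * g ^ 2)) := by field_simp; norm_num
        _ ≤ 256 * ε * g ^ 3 * (m * (v + v ^ 2 / (8 * lam))) := by gcongr
        _ = _ := by rw [hD]; ring
    have e6 := hmono v hv0.le
    have e7 : γ * ((v' - v) * (1 - 3 / 8 * g) + 8 * ε * g) ≤ v' - v := by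
      have : v' - v = γ * (twoPointExp lam θ' v' - twoPointExp lam θ v) := by linarith
      conv_rhs => rw [this]
      refine mul_le_mul_of_nonneg_left ?_ hγ0.le
      linarith
    -- The fixed point map for `θ'` has slope at least `1 - 3g/8` before discounting, so a vertical
    -- shift of order `ε g` moves the fixed point by order `ε`: here by at least `48 ε / 11 > 2 ε`.
    have e8 : 6 * ε * g ≤ (11 / 8 * g) * (v' - v) := by
      have h1 : 0 ≤ (v' - v) * g := mul_nonneg (sub_nonneg.2 hv1') hg.le
      have h2 : 0 < ε * g := mul_pos hε hg
      have h3 : γ * ((v' - v) * (3 / 8 * g)) ≤ (v' - v) * (3 / 8 * g) :=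
        mul_le_of_le_one_left (by linarith) hγ1.le
      have h4 : 3 / 4 * (8 * ε * g) ≤ γ * (8 * ε * g) :=
        mul_le_mul_of_nonneg_right hγ.le (by linarith)
      have h5 : γ * (v' - v) = (v' - v) - g * (v' - v) := by rw [hγg]; ring
      linarith
    have e9 : 6 * ε ≤ 11 / 8 * (v' - v) := by
      refine le_of_mul_le_mul_right ?_ hg
      linarith
    linarith
  · linarith [mul_le_mul_of_nonneg_left hg4.le hl.le]
  · have := mul_le_mul_of_nonneg_left (hmono' v' hv0'.le) hγ0.le
    linarith
  · rw [← hgdef, div_le_iff₀ (mul_pos (by linarith) (by linarith))]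
    have e1 : θ / 4 ≤ θ' * (1 - θ') := by
      calc θ / 4 = θ / 2 * (1 / 2) := by ring
        _ ≤ θ' * (1 - θ') := by gcongr; linarith
    -- `D² / (θ/4) = 2^20 ε² m g⁴`, and `m g ≤ 1` removes the dependence on `lam`.
    have e2 : (θ - θ') ^ 2 = 2 ^ 20 * ε ^ 2 * (g ^ 3 * (m * g)) * (θ / 4) := by
      rw [hθ', sub_sub_cancel, hD, hθ]
      ring
    rw [e2]
    have e3 : g ^ 3 * (m * g) ≤ g ^ 3 := mul_le_of_le_one_right (by positivity) hmg
    calc _ ≤ 2 ^ 20 * ε ^ 2 * g ^ 3 * (θ / 4) := by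
          gcongr
      _ ≤ _ := by gcongr

end Scalar

/-! ### Assembly of the lower bound over all pairs. -/

section LowerBound

lemma Algorithm.outputProb_mono {S A : Type*} (alg : Algorithm S A) (P : S → A → S → ℝ) {B B' : Set (S → ℝ)}
    (h : B ⊆ B') : alg.outputProb P B ≤ alg.outputProb P B' :=
  ENNReal.tsum_le_tsum fun _ => mul_le_mul_right (measure_mono h) _

variable {S A : Type*} [Fintype S] [Fintype A]

/-- Estimating the optimal robust value function of all models with the rewards of the escape
model requires order `|S| |A| / (ε² (1 - γ)³)` samples. -/
theorem sampleLowerBound_of_le [Nontrivial S] [Nonempty A] {γ lam c : ℝ} {b : ℝ → ℝ}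
    (hγ : 3 / 4 < γ) (hγ1 : γ < 1) (hl : 0 < lam)
    (hb : ∀ ε, 0 < ε → c * b ε ≤
      Fintype.card S * Fintype.card A / (5 * 2 ^ 20 * ε ^ 2 * (1 - γ) ^ 3)) :
    SampleLowerBound S A chiSq lam γ (1 / 512) c b := by
  classical
  obtain ⟨s₀, -⟩ := exists_pair_ne S
  have hγ0 : 0 ≤ γ := by linarith
  refine ⟨escapeReward s₀, {P | IsTransition P}, escapeReward_mem, fun P hP => hP, ?_⟩
  intro ε δ hε hε1 _ hδ1 alg halg
  obtain ⟨θ, θ', v, v', hθ, hθ', hθθ, hv0, hvv, hvθ, hv, hv', hvle, hκ⟩ :=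
    exists_escape_pair hγ hγ1 hl hε hε1
  have hg3 : 0 < (1 - γ) ^ 3 := pow_pos (by linarith) 3
  have hδ : ENNReal.ofReal (3 / 4) ≤ ENNReal.ofReal (1 - δ) :=
    ENNReal.ofReal_le_ofReal (by linarith)
  have hv0' : 0 ≤ v' := by linarith
  have hvθ0 : v * θ ≤ 2 * lam := (mul_le_mul_of_nonneg_right (by linarith) hθ.1.le).trans hvθ
  have hT₀ := isTransition_escapeModel (S := S) (A := A) (s₀ := s₀) (θ := fun _ _ => θ)
    fun _ _ => hθ
  have hV₀ := (isBellman_escapeModel (S := S) (A := A) (s₀ := s₀) (θ := fun _ _ => θ) (γ := γ)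
    (V := fun s => if s = s₀ then 0 else v) hl (fun _ _ => hθ) (by simp)
    (fun s => by split_ifs <;> linarith)
    (fun s _ => by split_ifs <;> linarith)
    (fun s hs _ => by simp only [hs, if_false]; exact hv.ge)
    (fun s hs => ⟨Classical.arbitrary A, by simp only [hs, if_false]; exact hv⟩)).optimalValue_eq
    hl hγ0 hγ1 escapeReward_mem hT₀
  refine ⟨escapeModel s₀ fun _ _ => θ, hT₀, ?_⟩
  have hpair : ∀ s₁, s₁ ≠ s₀ → ∀ a₁, ENNReal.ofReal (2 / (5 * (2 ^ 20 * ε ^ 2 * (1 - γ) ^ 3))) ≤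
      alg.expectedQueries (escapeModel s₀ fun _ _ => θ) s₁ a₁ := by
    intro s₁ hs₁ a₁
    set θ₁ : S → A → ℝ := fun s a => if s = s₁ ∧ a = a₁ then θ' else θ with hθ₁
    have hθ₁m : ∀ s a, θ₁ s a ∈ Set.Ioo (0 : ℝ) 1 := fun s a => by
      rw [hθ₁]; beta_reduce; split_ifs; exacts [hθ', hθ]
    have hθ₁θ : ∀ s a, θ₁ s a ≤ θ := fun s a => by
      rw [hθ₁]; beta_reduce; split_ifs; exacts [hθθ, le_rfl]
    have hθ₁s : ∀ s a, s ≠ s₁ → θ₁ s a = θ := fun s a hs => if_neg fun h => hs h.1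
    have hT₁ := isTransition_escapeModel (s₀ := s₀) hθ₁m
    -- A state moves only to itself or to the sink, so the altered pair affects the value at `s₁`
    -- alone. There `a₁` becomes optimal, and `hvle` says that the unaltered actions do not beat it.
    have hV₁ := (isBellman_escapeModel (s₀ := s₀) (θ := θ₁) (γ := γ)
      (V := fun s => if s = s₀ then 0 else if s = s₁ then v' else v) hl hθ₁m (by simp)
      (fun s => by split_ifs <;> linarith)
      (fun s a => by
        have h1 := mul_le_mul_of_nonneg_left (hθ₁θ s a) hv0
        have h2 := mul_le_mul_of_nonneg_left (hθ₁θ s a) hv0'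
        split_ifs <;> linarith)
      (fun s hs a => by
        simp only [hs, if_false]
        by_cases h : s = s₁
        · simp only [h, if_true]
          by_cases h' : a = a₁
          · rw [hθ₁]; simp only [h', and_self, if_true]; exact hv'.ge
          · rw [hθ₁]; simp only [h', and_false, if_false]; exact hvle
        · simp only [h, if_false, hθ₁s s a h]; exact hv.ge)
      (fun s hs => ⟨a₁, by
        simp only [hs, if_false]
        by_cases h : s = s₁
        · rw [hθ₁]; simp only [h, and_self, if_true]; exact hv'
        · simp only [h, if_false, hθ₁s s a₁ h]; exact hv⟩)).optimalValue_eq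
      hl hγ0 hγ1 escapeReward_mem hT₁
    refine alg.le_expectedQueries hT₀ hT₁
      (fun s a s' => by
        rw [escapeModel_eq_zero_iff (fun _ _ => hθ), escapeModel_eq_zero_iff hθ₁m])
      (fun s a hsa => ?_) (by positivity)
      ((sum_log_escapeModel_le (fun _ _ => hθ) hθ₁m hs₁ a₁).trans ?_)
      (B := {f | |f s₁ - v| ≤ ε}) (B' := {f | |f s₁ - v'| ≤ ε}) ?_ ?_ ?_ ?_
    · have : θ₁ s a = θ := if_neg fun h => hsa (by rw [h.1, h.2])
      funext s'
      simp only [escapeModel, this]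
    · have : θ₁ s₁ a₁ = θ' := if_pos ⟨rfl, rfl⟩
      rw [this]
      exact hκ
    · refine Set.disjoint_left.2 fun f h1 h2 => ?_
      have h1' := (abs_le.1 h1.out).2
      have h2' := (abs_le.1 h2.out).1
      linarith
    · have : Measurable fun f : S → ℝ => |f s₁ - v'| := by fun_prop
      exact measurableSet_le this measurable_const
    · refine hδ.trans ((halg _ hT₀).trans (alg.outputProb_mono _ fun f hf => ?_))
      have h1 := (norm_le_pi_norm _ s₁).trans hf.out
      rw [hV₀] at h1
      simpa [hs₁] using h1
    · refine hδ.trans ((halg _ hT₁).trans (alg.outputProb_mono _ fun f hf => ?_))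
      have h1 := (norm_le_pi_norm _ s₁).trans hf.out
      rw [hV₁] at h1
      simpa [hs₁] using h1
  set q := 2 / (5 * (2 ^ 20 * ε ^ 2 * (1 - γ) ^ 3)) with hq
  have hq0 : 0 ≤ q := by positivity
  -- The sink is left out of the count; `|S| - 1 ≥ |S|/2` costs a factor 2, offset by the 2 in the
  -- numerator of `q`.
  have hcard : (2 : ℝ) ≤ Fintype.card S := by exact_mod_cast Fintype.one_lt_card (α := S)
  have hcard' : (((Finset.univ.erase s₀).card : ℕ) : ℝ) = Fintype.card S - 1 := by
    rw [Finset.card_erase_of_mem (Finset.mem_univ _), Finset.card_univ,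
      Nat.cast_sub Fintype.card_pos, Nat.cast_one]
  rw [alg.expectedSamples_eq_sum hT₀]
  calc ENNReal.ofReal (c * b ε) ≤
      ENNReal.ofReal (((Finset.univ.erase s₀).card : ℝ) * (Fintype.card A * q)) := by
        refine ENNReal.ofReal_le_ofReal ((hb ε hε).trans ?_)
        rw [hcard']
        calc _ = (Fintype.card S / 2 : ℝ) * (Fintype.card A * q) := by rw [hq]; field_simp
          _ ≤ _ := by gcongr; linarith
    _ = ∑ s ∈ Finset.univ.erase s₀, ∑ _a : A, ENNReal.ofReal q := by
        rw [Finset.sum_const, Finset.sum_const, Finset.card_univ, nsmul_eq_mul, nsmul_eq_mul,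
          ENNReal.ofReal_mul (Nat.cast_nonneg _), ENNReal.ofReal_mul (Nat.cast_nonneg _),
          ENNReal.ofReal_natCast, ENNReal.ofReal_natCast]
    _ ≤ ∑ s ∈ Finset.univ.erase s₀, ∑ a : A,
          alg.expectedQueries (escapeModel s₀ fun _ _ => θ) s a :=
        Finset.sum_le_sum fun s hs => Finset.sum_le_sum fun a _ =>
          hpair s (Finset.ne_of_mem_erase hs) a
    _ ≤ _ := Finset.sum_le_sum_of_subset (Finset.subset_univ _)

end LowerBound

end

end RobustMDP

theorem theorem2 :
    -- upper bound, with an absolute constant `K` and the logarithmic factor written out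
    (∃ K : ℝ, 0 < K ∧
      ∀ (S A Ω : Type*) [Fintype S] [Nonempty S] [Fintype A] [Nonempty A]
        [MeasurableSpace S] [MeasurableSingletonClass S] [MeasurableSpace Ω]
        (μ : Measure Ω) [IsProbabilityMeasure μ]
        (γ lam δ : ℝ) (_ : 0 ≤ γ) (_ : γ < 1) (_ : 0 < lam) (_ : 0 < δ) (_ : δ < 1)
        (R : S → A → ℝ) (_ : ∀ s a, R s a ∈ Set.Icc (0 : ℝ) 1)
        (P : S → A → S → ℝ) (_ : RobustMDP.IsTransition P)
        (n : ℕ) (_ : 0 < n)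
        (X : S × A × Fin n → Ω → S) (_ : ∀ j, Measurable (X j)) (_ : iIndepFun X μ)
        (_ : ∀ s a i s', μ {ω | X (s, a, i) ω = s'} = ENNReal.ofReal (P s a s')),
        ENNReal.ofReal (1 - δ) ≤
          μ {ω | ‖RobustMDP.optimalValue RobustMDP.chiSq lam γ R
                    (RobustMDP.empirical fun j => X j ω) -
                  RobustMDP.optimalValue RobustMDP.chiSq lam γ R P‖ ≤
            K * (max (1 / (lam * (1 - γ) ^ 2)) lam / ((1 - γ) * √(n : ℝ))) *
              √(Real.log ((2 * Fintype.card S * Fintype.card A / δ) *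
                (1 + 8 * max (1 / (lam * (1 - γ))) 1 * √(2 * (n : ℝ)))))}) ∧
    -- lower bound for `λ = O(1 - γ)`
    (∀ C : ℝ, 0 < C → ∃ c ε₀ : ℝ, 0 < c ∧ 0 < ε₀ ∧
      ∀ (S A : Type*) [Fintype S] [Nontrivial S] [Fintype A] [Nonempty A]
        (γ lam : ℝ) (_ : 3 / 4 < γ) (_ : γ < 1) (_ : 0 < lam) (_ : lam ≤ C * (1 - γ)),
        RobustMDP.SampleLowerBound S A RobustMDP.chiSq lam γ ε₀ c fun ε =>
          Fintype.card S * Fintype.card A * lam ^ 2 / (ε ^ 2 * (1 - γ) ^ 3)) ∧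
    -- lower bound for `λ = Ω(1 - γ)`
    (∀ C : ℝ, 0 < C → ∃ c ε₀ : ℝ, 0 < c ∧ 0 < ε₀ ∧
      ∀ (S A : Type*) [Fintype S] [Nontrivial S] [Fintype A] [Nonempty A]
        (γ lam : ℝ) (_ : 3 / 4 < γ) (_ : γ < 1) (_ : C * (1 - γ) ≤ lam),
        RobustMDP.SampleLowerBound S A RobustMDP.chiSq lam γ ε₀ c fun ε =>
          Fintype.card S * Fintype.card A / (ε ^ 2 * (1 - γ) ^ 3) *
            min (1 / 16) (lam * γ * (1 - γ) / (2 * γ - 1))) := by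
  refine ⟨⟨5, by norm_num, ?_⟩, ?_, ?_⟩
  · intro S A Ω _ _ _ _ _ _ _ μ _ γ lam δ hγ0 hγ1 hl hδ0 hδ1 R hR P hP n hn X hX hind hlaw
    exact RobustMDP.optimalValue_empirical_deviation hγ0 hγ1 hl hδ0 hδ1 hR hP hn hX hind hlaw
  · intro C hC
    -- Here `lam ≤ C (1 - γ) ≤ C`, so `lam² / C² ≤ 1` and the claim is weaker than the bound free of
    -- `lam`.
    refine ⟨1 / (5 * 2 ^ 20 * C ^ 2), 1 / 512, by positivity, by norm_num, ?_⟩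
    intro S A _ _ _ _ γ lam hγ hγ1 hl hlC
    refine RobustMDP.sampleLowerBound_of_le hγ hγ1 hl fun ε hε => ?_
    have hg : 0 < 1 - γ := by linarith
    have h1 : lam ≤ C := hlC.trans (mul_le_of_le_one_right hC.le (by linarith))
    have h2 : lam ^ 2 / C ^ 2 ≤ 1 := by
      rw [div_le_one (by positivity)]
      exact pow_le_pow_left₀ hl.le h1 2
    calc _ = Fintype.card S * Fintype.card A / (5 * 2 ^ 20 * ε ^ 2 * (1 - γ) ^ 3) *
          (lam ^ 2 / C ^ 2) := by field_simp
      _ ≤ _ := mul_le_of_le_one_right (by positivity) h2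
  · intro C hC
    -- The minimum is at most `1/16`, so this claim too is weaker than the bound free of `lam`; `C`
    -- serves only to make `lam` positive.
    refine ⟨1 / (5 * 2 ^ 20), 1 / 512, by positivity, by norm_num, ?_⟩
    intro S A _ _ _ _ γ lam hγ hγ1 hlC
    have hg : 0 < 1 - γ := by linarith
    refine RobustMDP.sampleLowerBound_of_le hγ hγ1 ((mul_pos hC hg).trans_le hlC) fun ε hε => ?_
    have h1 : min (1 / 16) (lam * γ * (1 - γ) / (2 * γ - 1)) ≤ 1 :=
      (min_le_left _ _).trans (by norm_num)
    calc _ = Fintype.card S * Fintype.card A / (5 * 2 ^ 20 * ε ^ 2 * (1 - γ) ^ 3) *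
          min (1 / 16) (lam * γ * (1 - γ) / (2 * γ - 1)) := by field_simp
      _ ≤ _ := mul_le_of_le_one_right (by positivity) h1
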